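/- Assume projective determinacy (PD): for every projective set $A\subseteq\mathbb N^{\mathbb N}$, in the infinite two-player game of perfect information in which the players alternately choose natural numbers and player I wins if and only if the resulting sequence lies in $A$, one of the two players has a winning strategy. Let $d\ge 1$ and let $M$ be a nonempty topological manifold of dimension $d$ (Hausdorff and second countable; $M$ may have nonempty boundary and need not be compact or connected). Let $\mathrm{Homeo}(M)$ be the group of all homeomorphisms of $M$, and let $\mathrm{Homeo}_0(M)$ be its subgroup of homeomorphisms isotopic to the identity, i.e. the path component of the identity in the compact-open topology. For $g\in\mathrm{Homeo}(M)$, let $\mathrm{tp}(g)$ be the set of all first-order formulas $\varphi(v)$ in one free variable, in the language of groups (binary multiplication and identity), such that $\mathrm{Homeo}(M)\models\varphi(g)$. Then there exist $g_1,g_2\in\mathrm{Homeo}_0(M)$ such that $\mathrm{tp}(g_1)=\mathrm{tp}(g_2)$, but $g_1$ and $g_2$ are not conjugate in $\mathrm{Homeo}(M)$. -/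

import Mathlib

namespace HomeoTypes

/-! ### Projective sets and projective determinacy -/

/-- `IsSigma n X A` says that `A` is a boldface `Σ¹_{n+1}` subset of the Polish space `X`: the
`Σ¹_1` sets are the analytic ones, and the `Σ¹_{n+2}` sets are the projections to `X` of the
`Π¹_{n+1}` subsets (complements of `Σ¹_{n+1}` sets) of `X × ℕ^ℕ`. -/
def IsSigma : ℕ → ∀ (X : Type) [TopologicalSpace X], Set X → Prop
  | 0, _, _, A => MeasureTheory.AnalyticSet A
  | n + 1, X, _, A => ∃ B : Set (X × (ℕ → ℕ)), IsSigma n (X × (ℕ → ℕ)) Bᶜ ∧ A = Prod.fst '' B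

/-- A subset of a Polish space is projective if it is `Σ¹_{n+1}` for some `n`. (Every `Π¹_{n+1}`
set is `Σ¹_{n+2}`, so nothing is lost by mentioning only the classes `Σ¹_{n+1}`.) -/
def IsProjective {X : Type} [TopologicalSpace X] (A : Set X) : Prop :=
  ∃ n : ℕ, IsSigma n X A

/-- A strategy, for either player, in a game on `ℕ`: it assigns a move to every finite sequence
of moves. -/
abbrev Strategy : Type := List ℕ → ℕ

/-- The position reached after the first `k` moves of the run `x`. -/
def position (x : ℕ → ℕ) (k : ℕ) : List ℕ :=
  (List.range k).map x

/-- Player I moves at the even stages. In the run `x`, player I follows the strategy `s`. -/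
def FollowsI (s : Strategy) (x : ℕ → ℕ) : Prop :=
  ∀ k : ℕ, x (2 * k) = s (position x (2 * k))

/-- Player II moves at the odd stages. In the run `x`, player II follows the strategy `s`. -/
def FollowsII (s : Strategy) (x : ℕ → ℕ) : Prop :=
  ∀ k : ℕ, x (2 * k + 1) = s (position x (2 * k + 1))

/-- The infinite game of perfect information on `ℕ` in which player I wins the run `x` if and
only if `x ∈ A` is determined: one of the two players has a winning strategy. -/
def Determined (A : Set (ℕ → ℕ)) : Prop :=
  (∃ s : Strategy, ∀ x : ℕ → ℕ, FollowsI s x → x ∈ A) ∨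
    (∃ s : Strategy, ∀ x : ℕ → ℕ, FollowsII s x → x ∉ A)

/-- The axiom of projective determinacy (PD): every game on `ℕ` with a projective winning
condition is determined. -/
def ProjectiveDeterminacy : Prop :=
  ∀ A : Set (ℕ → ℕ), IsProjective A → Determined A

/-! ### Types in the language of groups -/

/-- The function symbols of the language of groups: a constant for the identity and a binary
multiplication. -/
inductive GroupFunc : ℕ → Type
  | one : GroupFunc 0
  | mul : GroupFunc 2

/-- The first-order language of groups; it has no relation symbols besides equality. -/
def groupLanguage : FirstOrder.Language :=
  { Functions := GroupFunc
    Relations := fun _ => Empty }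

/-- Every group is a structure in the language of groups. -/
instance groupStructure (G : Type*) [Group G] : groupLanguage.Structure G where
  funMap := fun {_} f =>
    match f with
    | GroupFunc.one => fun _ => 1
    | GroupFunc.mul => fun v => v 0 * v 1
  RelMap := fun {_} r => Empty.elim r

/-- The (complete, parameter-free) type of an element `g` of a group `G`: the set of all
first-order formulas `φ(v)` in one free variable such that `G ⊨ φ(g)`. -/
def tp {G : Type*} [Group G] (g : G) : Set (groupLanguage.Formula (Fin 1)) :=
  {φ | φ.Realize (fun _ : Fin 1 => g)}

/-! ### Manifolds and homeomorphisms -/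

/-- `M` is a topological manifold of dimension `d ≥ 1`, possibly with boundary, not necessarily
compact or connected: it is Hausdorff and second countable, and every point has an open
neighbourhood homeomorphic to an open subset of `ℝ^d` or of the closed half-space
`{x ∈ ℝ^d | 0 ≤ x 0}`. -/
structure IsManifoldOfDim (d : ℕ) [NeZero d] (M : Type*) [TopologicalSpace M] : Prop where
  t2 : T2Space M
  secondCountable : SecondCountableTopology M
  exists_chart : ∀ p : M,
    (∃ e : OpenPartialHomeomorph M (EuclideanSpace ℝ (Fin d)), p ∈ e.source) ∨
      (∃ e : OpenPartialHomeomorph M (EuclideanHalfSpace d), p ∈ e.source)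

/-- `Homeo₀(M)`: the homeomorphisms of `M` that are isotopic to the identity, that is, the path
component of the identity in the group `M ≃ₜ M` of all homeomorphisms of `M`. -/
def HomeoZero (M : Type*) [TopologicalSpace M] : Set (M ≃ₜ M) :=
  {g | ∃ H : unitInterval → (M ≃ₜ M),
    Continuous (fun q : unitInterval × M => H q.1 q.2) ∧ H 0 = 1 ∧ H 1 = g}

end HomeoTypes

namespace HomeoTypes

open MeasureTheory Set

/-! ### Projective sets -/

/-! Types are compared along a family of homeomorphisms `parityHomeo`, parametrised by `x` in Baire
space, with its coordinates indexed by the integers. In an interior chart the radii in `(0, 1)` are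
identified with the line; the homeomorphism fixes the spheres at integer parameters and pushes the
shell between `n` and `n + 1` outwards or inwards according to the parity of the `n`-th term of `x`.
Shrinking the amplitude to zero is an isotopy to the identity.

The types of generic members agree. Homeomorphisms can be coded by sequences so that equality and
composition are projective (`projectivelyCoded_decode`); by induction on formulas, the set of `x`
whose homeomorphism satisfies a given formula is projective. It is invariant under the shift,
because translating the radial parameter conjugates the member at `x` to the member at the shifted
sequence (`exists_parityHomeo_shift`). PD, applied to the Banach–Mazur game, makes a projective set
meagre or residual in a cylinder, and shift invariance turns this into a zero-one law
(`IsProjective.zero_one`). There are only countably many formulas, so the type is constant on a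
residual set.

Generic members are not conjugate. A conjugacy preserves heteroclinic connections between fixed
points, so it maps a chain of consecutive fixed points on a ray to such a chain. The parities are
thus determined on a half line up to a shift or a reflection (`exists_shift_of_isConj`), which
leaves a meagre set of parameters for each conjugacy class. The two facts meet in
`exists_tp_eq_not_isConj`. -/

instance polishSpace_nat_nat : PolishSpace (ℕ → ℕ) := inferInstance

instance polishSpace_prod {X Y : Type*} [TopologicalSpace X] [PolishSpace X] [TopologicalSpace Y]
    [PolishSpace Y] : PolishSpace (X × Y) := inferInstance

instance polishSpace_pi {ι X : Type*} [Countable ι] [TopologicalSpace X] [PolishSpace X] :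
    PolishSpace (ι → X) := inferInstance

instance baireSpace_nat_nat : BaireSpace (ℕ → ℕ) := inferInstance

/-- Pullback commutes with projection. The spaces are quantified inside the induction because each
level passes from `X` to `X × ℕ^ℕ`. -/
theorem IsSigma.preimage {n : ℕ} : ∀ {X Y : Type} [TopologicalSpace X] [PolishSpace X]
    [TopologicalSpace Y] [PolishSpace Y] {A : Set X} {f : Y → X},
    IsSigma n X A → Continuous f → IsSigma n Y (f ⁻¹' A) := by
  induction n with
  | zero => intro X Y _ _ _ _ A f hA hf; exact AnalyticSet.preimage hA hf
  | succ n ih =>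
    rintro X Y _ _ _ _ A f ⟨B, hB, rfl⟩ hf
    refine ⟨Prod.map f id ⁻¹' B, ?_, ?_⟩
    · exact ih hB (hf.prodMap continuous_id)
    · ext y
      constructor
      · rintro ⟨⟨x, z⟩, hxz, hx⟩
        exact ⟨(y, z), by simpa [← show x = f y from hx] using hxz, rfl⟩
      · rintro ⟨⟨y', z⟩, hz, rfl⟩
        exact ⟨(f y', z), hz, rfl⟩

theorem IsSigma.compl {n : ℕ} {X : Type} [TopologicalSpace X] [PolishSpace X] {A : Set X}
    (hA : IsSigma n X A) : IsSigma (n + 1) X Aᶜ := by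
  refine ⟨Prod.fst ⁻¹' Aᶜ, ?_, ?_⟩
  · rw [← preimage_compl, compl_compl]
    exact hA.preimage continuous_fst
  · exact (image_preimage_eq _ Prod.fst_surjective).symm

theorem isSigma_zero_of_measurableSet {X : Type} [TopologicalSpace X] [PolishSpace X]
    [MeasurableSpace X] [BorelSpace X] {A : Set X} (hA : MeasurableSet A) : IsSigma 0 X A :=
  hA.analyticSet

theorem IsSigma.succ {n : ℕ} : ∀ {X : Type} [TopologicalSpace X] [PolishSpace X] {A : Set X},
    IsSigma n X A → IsSigma (n + 1) X A := by
  induction n with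
  | zero =>
    intro X _ _ A hA
    have hA' : AnalyticSet A := hA
    rw [AnalyticSet] at hA'
    rcases hA' with rfl | ⟨f, hf, rfl⟩
    · exact ⟨∅, by borelize (X × (ℕ → ℕ)); exact isSigma_zero_of_measurableSet (by simp), by simp⟩
    -- The range of `f` is the projection of its transposed graph, which is closed.
    · refine ⟨{q | f q.2 = q.1}, ?_, ?_⟩
      · borelize (X × (ℕ → ℕ))
        exact isSigma_zero_of_measurableSet
          (isClosed_eq (hf.comp continuous_snd) continuous_fst).measurableSet.compl
      · ext x
        simp
  | succ n ih =>
    rintro X _ _ A ⟨B, hB, rfl⟩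
    exact ⟨B, ih hB, rfl⟩

theorem IsSigma.mono {m n : ℕ} (h : m ≤ n) {X : Type} [TopologicalSpace X] [PolishSpace X]
    {A : Set X} (hA : IsSigma m X A) : IsSigma n X A := by
  induction h with
  | refl => exact hA
  | step _ ih => exact ih.succ

/-- Separating the even and the odd coordinates maps `ℕ^ℕ` onto `ℕ^ℕ × ℕ^ℕ`. -/
theorem exists_continuous_surjective_prod : ∃ f : (ℕ → ℕ) → (ℕ → ℕ) × (ℕ → ℕ),
    Continuous f ∧ Function.Surjective f := by
  refine ⟨fun z => (fun n => z (2 * n), fun n => z (2 * n + 1)), by fun_prop, ?_⟩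
  rintro ⟨a, b⟩
  refine ⟨fun n => if n % 2 = 0 then a (n / 2) else b (n / 2), ?_⟩
  ext n
  · simp
  · have : (2 * n + 1) / 2 = n := by omega
    simp [this]

/-- The two claims need a joint induction, since complements exchange them. -/
theorem isSigma_union_inter (n : ℕ) : ∀ {X : Type} [TopologicalSpace X] [PolishSpace X]
    {A B : Set X}, IsSigma n X A → IsSigma n X B →
      IsSigma n X (A ∪ B) ∧ IsSigma n X (A ∩ B) := by
  induction n with
  | zero =>
    intro X _ _ A B hA hB
    constructor
    · rw [union_eq_iUnion]
      exact AnalyticSet.iUnion (by rintro (_ | _); exacts [hB, hA])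
    · rw [inter_eq_iInter]
      exact AnalyticSet.iInter (by rintro (_ | _); exacts [hB, hA])
  | succ n ih =>
    rintro X _ _ A B ⟨C, hC, rfl⟩ ⟨D, hD, rfl⟩
    constructor
    · refine ⟨C ∪ D, ?_, (image_union ..).symm⟩
      rw [compl_union]
      exact (ih hC hD).2
    · obtain ⟨f, hf, hfs⟩ := exists_continuous_surjective_prod
      -- One sequence carries both witnesses, in its even and odd coordinates.
      refine ⟨{q | (q.1, (f q.2).1) ∈ C} ∩ {q | (q.1, (f q.2).2) ∈ D}, ?_, ?_⟩
      · rw [compl_inter]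
        refine (ih ?_ ?_).1
        · exact hC.preimage (f := fun q : X × (ℕ → ℕ) => (q.1, (f q.2).1)) (by fun_prop)
        · exact hD.preimage (f := fun q : X × (ℕ → ℕ) => (q.1, (f q.2).2)) (by fun_prop)
      · ext x
        constructor
        · rintro ⟨⟨⟨_, c⟩, hc, rfl⟩, ⟨_, d⟩, hd, rfl⟩
          obtain ⟨z, hz⟩ := hfs (c, d)
          exact ⟨(_, z), ⟨by simpa [hz] using hc, by simpa [hz] using hd⟩, rfl⟩
        · rintro ⟨⟨x, z⟩, ⟨hc, hd⟩, rfl⟩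
          exact ⟨⟨_, hc, rfl⟩, ⟨_, hd, rfl⟩⟩

section Projective

variable {X Y : Type} [TopologicalSpace X] [PolishSpace X] [TopologicalSpace Y] [PolishSpace Y]

theorem IsProjective.preimage {A : Set X} (hA : IsProjective A) {f : Y → X} (hf : Continuous f) :
    IsProjective (f ⁻¹' A) :=
  let ⟨n, h⟩ := hA
  ⟨n, h.preimage hf⟩

theorem IsProjective.comp {P : X → Prop} (hP : IsProjective {x | P x}) {f : Y → X}
    (hf : Continuous f) : IsProjective {y | P (f y)} :=
  hP.preimage hf

theorem isProjective_of_measurableSet [MeasurableSpace X] [BorelSpace X] {A : Set X}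
    (hA : MeasurableSet A) : IsProjective A :=
  ⟨0, isSigma_zero_of_measurableSet hA⟩

theorem isProjective_of_isClosed {A : Set X} (hA : IsClosed A) : IsProjective A := by
  borelize X
  exact isProjective_of_measurableSet hA.measurableSet

theorem IsProjective.not {P : X → Prop} (hP : IsProjective {x | P x}) :
    IsProjective {x | ¬ P x} :=
  let ⟨n, h⟩ := hP
  ⟨n + 1, h.compl⟩

theorem IsProjective.and {P Q : X → Prop} (hP : IsProjective {x | P x})
    (hQ : IsProjective {x | Q x}) : IsProjective {x | P x ∧ Q x} :=
  let ⟨m, h⟩ := hP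
  let ⟨n, k⟩ := hQ
  ⟨max m n, (isSigma_union_inter _ (h.mono (le_max_left m n)) (k.mono (le_max_right m n))).2⟩

theorem IsProjective.imp {P Q : X → Prop} (hP : IsProjective {x | P x})
    (hQ : IsProjective {x | Q x}) : IsProjective {x | P x → Q x} := by
  simpa only [not_and, not_not] using (hP.and hQ.not).not

theorem IsProjective.or {P Q : X → Prop} (hP : IsProjective {x | P x})
    (hQ : IsProjective {x | Q x}) : IsProjective {x | P x ∨ Q x} := by
  simpa only [or_iff_not_imp_left] using hP.not.imp hQ

theorem IsProjective.iff {P Q : X → Prop} (hP : IsProjective {x | P x})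
    (hQ : IsProjective {x | Q x}) : IsProjective {x | P x ↔ Q x} := by
  simpa only [iff_iff_implies_and_implies] using (hP.imp hQ).and (hQ.imp hP)

theorem IsProjective.exists {P : X → (ℕ → ℕ) → Prop}
    (hP : IsProjective {q : X × (ℕ → ℕ) | P q.1 q.2}) : IsProjective {x | ∃ z, P x z} := by
  obtain ⟨n, h⟩ := hP
  refine ⟨n + 2, {q | P q.1 q.2}, h.compl, ?_⟩
  ext x
  simp

theorem IsProjective.forall {P : X → (ℕ → ℕ) → Prop}
    (hP : IsProjective {q : X × (ℕ → ℕ) | P q.1 q.2}) : IsProjective {x | ∀ z, P x z} := by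
  simpa only [not_exists, not_not] using
    (IsProjective.exists (P := fun x z => ¬ P x z) hP.not).not

end Projective

end HomeoTypes
namespace HomeoTypes

open Set Filter Topology

/-! ### The Banach–Mazur game -/

/-- The set of sequences that extend the finite sequence `w`. -/
def cylinder (w : List ℕ) : Set (ℕ → ℕ) :=
  {x | ∀ (i : ℕ) (h : i < w.length), x i = w[i]}

theorem isClopen_cylinder (w : List ℕ) : IsClopen (cylinder w) := by
  have : cylinder w = ⋂ i : Fin w.length, (fun x : ℕ → ℕ => x i) ⁻¹' {w[i]} := by
    ext x
    simp [cylinder, Fin.forall_iff]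
  rw [this]
  exact isClopen_iInter_of_finite fun i => (isClopen_discrete _).preimage (continuous_apply _)

theorem cylinder_anti {w w' : List ℕ} (h : w <+: w') : cylinder w' ⊆ cylinder w := by
  obtain ⟨t, rfl⟩ := h
  intro x hx i hi
  rw [hx i (by simp; omega), List.getElem_append_left hi]

theorem length_position (x : ℕ → ℕ) (k : ℕ) : (position x k).length = k := by
  simp [position]

theorem position_succ (x : ℕ → ℕ) (k : ℕ) : position x (k + 1) = position x k ++ [x k] := by
  simp [position, List.range_succ]

theorem position_prefix (x : ℕ → ℕ) {j k : ℕ} (h : j ≤ k) : position x j <+: position x k := by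
  induction h with
  | refl => exact List.prefix_rfl
  | step _ ih => exact ih.trans (by rw [position_succ]; exact List.prefix_append _ _)

theorem mem_cylinder_iff {x : ℕ → ℕ} {w : List ℕ} : x ∈ cylinder w ↔ position x w.length = w := by
  constructor
  · intro h
    refine List.ext_getElem (length_position ..) fun i h₁ h₂ => ?_
    simp [position, h i h₂]
  · intro h i hi
    have : (position x w.length)[i]'(by rwa [length_position]) = w[i] := by simp only [h]
    rw [← this]
    simp [position]

theorem exists_cylinder_subset {U : Set (ℕ → ℕ)} (hU : IsOpen U) {x : ℕ → ℕ} (hx : x ∈ U) :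
    ∃ k, ∀ l, k ≤ l → ∀ y : ℕ → ℕ, (∀ i < l, y i = x i) → y ∈ U := by
  obtain ⟨I, u, hu, hsub⟩ := isOpen_pi_iff.1 hU x hx
  obtain ⟨k, hk⟩ := I.bddAbove
  refine ⟨k + 1, fun l hl y hy => hsub fun i hi => ?_⟩
  rw [hy i (by have := hk hi; omega)]
  exact (hu i hi).2

theorem nonempty_cylinder (w : List ℕ) : ∃ y : ℕ → ℕ, y ∈ cylinder w :=
  ⟨fun i => w.getD i 0, fun i hi => by simp [hi]⟩

/-- In the Banach–Mazur game every move stands for a nonempty finite sequence. -/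
def moveList (m : ℕ) : List ℕ :=
  (Denumerable.ofNat (ℕ × List ℕ) m).1 :: (Denumerable.ofNat (ℕ × List ℕ) m).2

theorem exists_moveList {l : List ℕ} (hl : l ≠ []) : ∃ m, moveList m = l := by
  obtain ⟨a, l, rfl⟩ := List.exists_cons_of_ne_nil hl
  exact ⟨Encodable.encode (a, l), by simp [moveList]⟩

/-- The finite sequence built in a position of the Banach–Mazur game. -/
def concat (p : List ℕ) : List ℕ := p.flatMap moveList

theorem concat_append (p q : List ℕ) : concat (p ++ q) = concat p ++ concat q := by
  simp [concat]

theorem concat_prefix {p q : List ℕ} (h : p <+: q) : concat p <+: concat q := by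
  obtain ⟨t, rfl⟩ := h
  rw [concat_append]
  exact List.prefix_append _ _

/-- Every move contributes at least one term, so `n + 1` moves fix the term with index `n` and the
default value in `outcome` is never read. -/
theorem length_le_length_concat (p : List ℕ) : p.length ≤ (concat p).length := by
  induction p with
  | nil => simp
  | cons a p ih =>
    have : concat (a :: p) = moveList a ++ concat p := by simp [concat]
    rw [this]
    simp [moveList]
    omega

/-- The sequence built in a run of the Banach–Mazur game. -/
def outcome (z : ℕ → ℕ) (n : ℕ) : ℕ := (concat (position z (n + 1))).getD n 0

theorem continuous_outcome : Continuous outcome := by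
  refine continuous_pi fun n => ?_
  have h : (fun z => outcome z n) = (fun w : Fin (n + 1) → ℕ =>
      (concat (List.ofFn w)).getD n 0) ∘ fun z i => z i := by
    ext z
    have : position z (n + 1) = List.ofFn fun i : Fin (n + 1) => z i := by
      refine List.ext_getElem (by simp [position]) fun i h₁ h₂ => ?_
      rw [List.getElem_ofFn]
      simp [position]
    simp only [outcome, this, Function.comp_apply]
  rw [h]
  exact continuous_of_discreteTopology.comp (by fun_prop)

theorem outcome_eq {x z : ℕ → ℕ} (h : ∀ k, x ∈ cylinder (concat (position z k))) :
    outcome z = x := by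
  ext n
  have hn : n < (concat (position z (n + 1))).length := by
    have := length_le_length_concat (position z (n + 1))
    rw [length_position] at this
    omega
  rw [h (n + 1) n hn, outcome, List.getD_eq_getElem _ _ hn]

/-- If the player who replies in the Banach–Mazur game from the position `p₀` on has a strategy
that forces the outcome into `B`, then `B` is residual in the cylinder given by `p₀`. -/
theorem eventually_mem_of_reply_strategy (s : Strategy) (B : Set (ℕ → ℕ)) (p₀ : List ℕ)
    (hs : ∀ z : ℕ → ℕ, position z p₀.length = p₀ →
      (∀ k, z (p₀.length + 2 * k + 1) = s (position z (p₀.length + 2 * k + 1))) →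
        outcome z ∈ B) :
    ∀ᶠ x in residual (ℕ → ℕ), x ∈ cylinder (concat p₀) → x ∈ B := by
  set ext : List ℕ → ℕ → List ℕ := fun p m => p ++ [m, s (p ++ [m])] with hext
  -- For each of the countably many positions `p`, it is a dense open condition on `x` that if `x`
  -- extends `p`, then some move and the reply of the strategy keep the play along `x`.
  have key : ∀ᶠ x in residual (ℕ → ℕ), ∀ p : List ℕ, x ∈ cylinder (concat p) →
      ∃ m, x ∈ cylinder (concat (ext p m)) := by
    rw [eventually_countable_forall]
    intro p
    refine residual_of_dense_open ?_ ?_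
    · have : {x | x ∈ cylinder (concat p) → ∃ m, x ∈ cylinder (concat (ext p m))} =
          (cylinder (concat p))ᶜ ∪ ⋃ m, cylinder (concat (ext p m)) := by
        ext x
        simp only [mem_ofPred_eq, mem_union, mem_compl_iff, mem_iUnion]
        tauto
      rw [this]
      exact (isClopen_cylinder _).compl.isOpen.union
        (isOpen_iUnion fun m => (isClopen_cylinder _).isOpen)
    · rw [dense_iff_inter_open]
      rintro U hU ⟨x, hx⟩
      by_cases hxp : x ∈ cylinder (concat p)
      swap
      · exact ⟨x, hx, fun h => (hxp h).elim⟩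
      obtain ⟨k, hk⟩ := exists_cylinder_subset hU hx
      -- Long enough to stay inside `U`, and strictly longer than the current word so that the next
      -- move is nonempty.
      set l := max k ((concat p).length + 1) with hl
      obtain ⟨t, ht⟩ : concat p <+: position x l := by
        conv_lhs => rw [← mem_cylinder_iff.1 hxp]
        exact position_prefix x (by omega)
      have htne : t ≠ [] := by
        rintro rfl
        have := congrArg List.length ht
        rw [List.append_nil, length_position] at this
        omega
      obtain ⟨m, rfl⟩ := exists_moveList htne
      have hpre : position x l <+: concat (ext p m) := by
        refine ⟨moveList (s (p ++ [m])), ?_⟩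
        rw [← ht, hext, concat_append]
        simp [concat]
      obtain ⟨y, hy⟩ := nonempty_cylinder (concat (ext p m))
      refine ⟨y, hk l (le_max_left _ _) y fun i hi => ?_, fun _ => ⟨m, hy⟩⟩
      rw [cylinder_anti hpre hy i (by rwa [length_position])]
      simp [position]
  filter_upwards [key] with x hx hx₀
  choose! m hm using hx
  -- Iterating `key` gives a run that obeys the strategy and has outcome `x`; hence `x ∈ B`.
  obtain ⟨P, hP₀, hP⟩ : ∃ P : ℕ → List ℕ, P 0 = p₀ ∧
      ∀ k, P (k + 1) = P k ++ [m (P k), s (P k ++ [m (P k)])] :=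
    ⟨fun k => Nat.rec p₀ (fun _ p => ext p (m p)) k, rfl, fun _ => rfl⟩
  have hPx : ∀ k, x ∈ cylinder (concat (P k)) := by
    intro k
    induction k with
    | zero => rwa [hP₀]
    | succ k ih => rw [hP]; exact hm _ ih
  have hPlen : ∀ k, (P k).length = p₀.length + 2 * k := by
    intro k
    induction k with
    | zero => rw [hP₀]; rfl
    | succ k ih => rw [hP]; simp [ih]; ring
  have hPmono : ∀ {j k}, j ≤ k → P j <+: P k := by
    intro j k h
    induction h with
    | refl => exact List.prefix_rfl
    | step _ ih => exact ih.trans (by rw [hP]; exact List.prefix_append _ _)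
  -- `P (i + 1)` has more than `i` entries, so the default is not used.
  let z : ℕ → ℕ := fun i => (P (i + 1)).getD i 0
  have hz : ∀ k, z ∈ cylinder (P k) := by
    intro k i hi
    have hi' : i < (P (i + 1)).length := by rw [hPlen]; omega
    have hzi : z i = (P (i + 1))[i] := List.getD_eq_getElem _ _ hi'
    rw [hzi]
    rcases le_total k (i + 1) with h | h
    · exact ((hPmono h).getElem hi).symm
    · exact (hPmono h).getElem hi'
  have hzP : ∀ k, position z (p₀.length + 2 * k) = P k := fun k => by
    rw [← hPlen]; exact mem_cylinder_iff.1 (hz k)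
  have hout : outcome z = x := by
    refine outcome_eq fun k => cylinder_anti (concat_prefix ?_) (hPx k)
    rw [← hzP]
    exact position_prefix z (by omega)
  rw [← hout]
  refine hs z ((hzP 0).trans hP₀) fun k => ?_
  have h2 := hzP (k + 1)
  rw [hP, show p₀.length + 2 * (k + 1) = p₀.length + 2 * k + 1 + 1 by ring, position_succ,
    position_succ, hzP] at h2
  simp only [List.append_assoc, List.cons_append, List.nil_append, List.append_cancel_left_eq,
    List.cons.injEq, and_true] at h2
  rw [position_succ, hzP, h2.1, h2.2]

/-- Under PD, every projective set is meagre or residual in some cylinder. -/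
theorem IsProjective.eventually_notMem_or {A : Set (ℕ → ℕ)} (hPD : ProjectiveDeterminacy)
    (hA : IsProjective A) :
    (∀ᶠ x in residual (ℕ → ℕ), x ∉ A) ∨
      ∃ w : List ℕ, ∀ᶠ x in residual (ℕ → ℕ), x ∈ cylinder w → x ∈ A := by
  rcases hPD _ (hA.preimage continuous_outcome) with ⟨s, hs⟩ | ⟨s, hs⟩
  -- After the opening move `s []`, player I is the one who replies.
  · refine Or.inr ⟨concat [s []], eventually_mem_of_reply_strategy s A [s []] fun z h0 hz => ?_⟩
    refine hs z fun k => ?_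
    rcases k with _ | k
    · simpa [position, List.range_succ] using h0
    · have := hz k
      simp only [List.length_singleton] at this
      rwa [show 2 * (k + 1) = 1 + 2 * k + 1 by ring]
  · left
    have := eventually_mem_of_reply_strategy s Aᶜ [] fun z _ hz => hs z fun k => by
      simpa using hz k
    filter_upwards [this] with x hx
    exact hx fun i hi => by simp [concat] at hi

/-! ### The shift -/

/-- The shift by `k` of sequences of natural numbers whose terms are indexed by the integers. -/
def shift (k : ℤ) (x : ℕ → ℕ) (n : ℕ) : ℕ :=
  x (Equiv.intEquivNat (Equiv.intEquivNat.symm n + k))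

theorem shift_shift (j k : ℤ) (x : ℕ → ℕ) : shift j (shift k x) = shift (j + k) x := by
  ext n
  simp [shift, add_assoc]

theorem shift_zero (x : ℕ → ℕ) : shift 0 x = x := by
  ext n
  simp [shift]

/-- The shift as a homeomorphism of Baire space. -/
def shiftHomeo (k : ℤ) : (ℕ → ℕ) ≃ₜ (ℕ → ℕ) where
  toFun := shift k
  invFun := shift (-k)
  left_inv x := by simp [shift_shift, shift_zero]
  right_inv x := by simp [shift_shift, shift_zero]
  continuous_toFun := continuous_pi fun n => continuous_apply _
  continuous_invFun := continuous_pi fun n => continuous_apply _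

/-- A basic open set restricts finitely many coordinates, and all but finitely many shifts move the
coordinates of `w` away from them. -/
theorem dense_iUnion_shift_preimage_cylinder (w : List ℕ) :
    Dense (⋃ k : ℤ, shift k ⁻¹' cylinder w) := by
  rw [dense_iff_inter_open]
  rintro U hU ⟨x, hx⟩
  obtain ⟨l, hl⟩ := exists_cylinder_subset hU hx
  set e := Equiv.intEquivNat
  obtain ⟨k, hk⟩ := Infinite.exists_notMem_finset
    ((Finset.range l ×ˢ Finset.range w.length).image fun q => e.symm q.1 - e.symm q.2)
  refine ⟨fun n => if n < l then x n else w.getD (e (e.symm n - k)) 0,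
    hl l le_rfl _ fun i hi => by simp [hi], mem_iUnion.2 ⟨k, fun i hi => ?_⟩⟩
  have : ¬ e (e.symm i + k) < l := fun h => hk <| Finset.mem_image.2
    ⟨(e (e.symm i + k), i), by simp [h, hi], by simp⟩
  simp [shift, e, this, hi]

/-- The topological zero-one law: under PD, a shift-invariant projective set or its complement is
residual. -/
theorem IsProjective.zero_one {A : Set (ℕ → ℕ)} (hPD : ProjectiveDeterminacy)
    (hA : IsProjective A) (hinv : ∀ k x, shift k x ∈ A → x ∈ A) :
    (∀ᶠ x in residual (ℕ → ℕ), x ∈ A) ∨ (∀ᶠ x in residual (ℕ → ℕ), x ∉ A) := by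
  rcases hA.eventually_notMem_or hPD with h | ⟨w, hc⟩
  · exact Or.inr h
  left
  have h₁ : ∀ᶠ x in residual (ℕ → ℕ), x ∈ ⋃ k : ℤ, shift k ⁻¹' cylinder w :=
    residual_of_dense_open
      (isOpen_iUnion fun k => (isClopen_cylinder w).isOpen.preimage (shiftHomeo k).continuous)
      (dense_iUnion_shift_preimage_cylinder w)
  have h₂ : ∀ᶠ x in residual (ℕ → ℕ), ∀ k : ℤ, shift k x ∈ cylinder w → shift k x ∈ A := by
    rw [eventually_countable_forall]
    intro k
    -- A homeomorphism preserves the residual filter, so residuality in the cylinder can be pulled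
    -- back along every shift.
    rw [← (shiftHomeo k).residual_map_eq, eventually_map] at hc
    exact hc
  filter_upwards [h₁, h₂] with x hx hx'
  obtain ⟨k, hk⟩ := mem_iUnion.1 hx
  exact hinv k x (hx' k hk)

/-- A generic sequence does not have prescribed parities along infinitely many coordinates. -/
theorem eventually_exists_parity_ne {ι : ℕ → ℕ} (hι : Function.Injective ι) (b : ℕ → Prop) :
    ∀ᶠ y in residual (ℕ → ℕ), ∃ j, ¬ (Even (y (ι j)) ↔ b j) := by
  refine residual_of_dense_open ?_ ?_
  · have : {y : ℕ → ℕ | ∃ j, ¬ (Even (y (ι j)) ↔ b j)} =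
        ⋃ j, (fun y : ℕ → ℕ => y (ι j)) ⁻¹' {n | ¬ (Even n ↔ b j)} := by
      ext y; simp
    rw [this]
    exact isOpen_iUnion fun j => (isOpen_discrete _).preimage (continuous_apply _)
  · rw [dense_iff_inter_open]
    rintro U hU ⟨x, hx⟩
    obtain ⟨l, hl⟩ := exists_cylinder_subset hU hx
    obtain ⟨j, hj⟩ : ∃ j, l ≤ ι j := by
      by_contra! h
      exact not_injective_infinite_finite (fun j => (⟨ι j, h j⟩ : Fin l))
        fun a b hab => hι (by simpa using hab)
    classical
    refine ⟨Function.update x (ι j) (if b j then 1 else 0),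
      hl l le_rfl _ fun i hi => Function.update_of_ne (by omega) _ _, j, ?_⟩
    by_cases hb : b j <;> simp [hb]

end HomeoTypes
namespace HomeoTypes

open Set Filter Topology FirstOrder

/-! ### Definability over a group coded by sequences -/

/-- `ProjectivelyCoded dec` says that the coding `dec` of the elements of the group `G` by
sequences of natural numbers makes the group operations and the equality projective. -/
structure ProjectivelyCoded {G : Type*} [Group G] (dec : (ℕ → ℕ) → G) : Prop where
  surjective : Function.Surjective dec
  eq : IsProjective {q : (ℕ → ℕ) × (ℕ → ℕ) | dec q.1 = dec q.2}
  one : IsProjective {a : ℕ → ℕ | dec a = 1}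
  mul : IsProjective {q : (ℕ → ℕ) × (ℕ → ℕ) × (ℕ → ℕ) | dec q.1 * dec q.2.1 = dec q.2.2}

section Coded

variable {G : Type*} [Group G] {dec : (ℕ → ℕ) → G}

/-- Stated for the graph of the term, so that a product is handled by quantifying over codes of the
values of its factors. -/
theorem ProjectivelyCoded.term (h : ProjectivelyCoded dec) {α : Type} [Countable α]
    (t : groupLanguage.Term α) :
    IsProjective {q : (α → ℕ → ℕ) × (ℕ → ℕ) | t.realize (fun i => dec (q.1 i)) = dec q.2} := by
  induction t with
  | var i =>
    exact h.eq.comp (f := fun q : (α → ℕ → ℕ) × (ℕ → ℕ) => (q.1 i, q.2)) (by fun_prop)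
  | func f ts ih =>
    cases f with
    | one =>
      have := h.one.comp (f := fun q : (α → ℕ → ℕ) × (ℕ → ℕ) => q.2) continuous_snd
      refine (congrArg IsProjective ?_).mp this
      ext q
      exact eq_comm
    | mul =>
      have h₀ := (ih 0).comp (f := fun q : (((α → ℕ → ℕ) × (ℕ → ℕ)) × (ℕ → ℕ)) × (ℕ → ℕ) =>
        (q.1.1.1, q.1.2)) (by fun_prop)
      have h₁ := (ih 1).comp (f := fun q : (((α → ℕ → ℕ) × (ℕ → ℕ)) × (ℕ → ℕ)) × (ℕ → ℕ) =>
        (q.1.1.1, q.2)) (by fun_prop)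
      have h₂ := h.mul.comp (f := fun q : (((α → ℕ → ℕ) × (ℕ → ℕ)) × (ℕ → ℕ)) × (ℕ → ℕ) =>
        (q.1.2, q.2, q.1.1.2)) (by fun_prop)
      have := (IsProjective.exists (X := (α → ℕ → ℕ) × (ℕ → ℕ)) (P := fun q a => ∃ b,
          (ts 0).realize (fun i => dec (q.1 i)) = dec a ∧
          (ts 1).realize (fun i => dec (q.1 i)) = dec b ∧ dec a * dec b = dec q.2)
        (IsProjective.exists (X := ((α → ℕ → ℕ) × (ℕ → ℕ)) × (ℕ → ℕ)) (P := fun z b =>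
          (ts 0).realize (fun i => dec (z.1.1 i)) = dec z.2 ∧
          (ts 1).realize (fun i => dec (z.1.1 i)) = dec b ∧ dec z.2 * dec b = dec z.1.2)
          (h₀.and (h₁.and h₂))))
      refine (congrArg IsProjective ?_).mp this
      ext q
      change (∃ a b, _) ↔ (ts 0).realize (fun i => dec (q.1 i)) *
        (ts 1).realize (fun i => dec (q.1 i)) = dec q.2
      constructor
      · rintro ⟨a, b, ha, hb, hab⟩
        rw [ha, hb, hab]
      · intro hq
        obtain ⟨a, ha⟩ := h.surjective ((ts 0).realize (fun i => dec (q.1 i)))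
        obtain ⟨b, hb⟩ := h.surjective ((ts 1).realize (fun i => dec (q.1 i)))
        exact ⟨a, b, ha.symm, hb.symm, by rw [ha, hb, hq]⟩

/-- Since `dec` is surjective, a quantifier over `G` is a quantifier over Baire space, under which
projective sets are closed. -/
theorem ProjectivelyCoded.boundedFormula (h : ProjectivelyCoded dec) {α : Type} [Countable α]
    {n : ℕ} (φ : groupLanguage.BoundedFormula α n) :
    IsProjective {q : (α → ℕ → ℕ) × (Fin n → ℕ → ℕ) |
      φ.Realize (fun i => dec (q.1 i)) (fun i => dec (q.2 i))} := by
  induction φ with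
  | falsum =>
    refine isProjective_of_isClosed ?_
    convert! isClosed_empty
  | @equal n t₁ t₂ =>
    have hc : Continuous fun q : ((α → ℕ → ℕ) × (Fin n → ℕ → ℕ)) × (ℕ → ℕ) =>
        (Sum.elim q.1.1 q.1.2, q.2) := by
      refine (continuous_pi ?_).prodMk continuous_snd
      rintro (i | i) <;> simp only [Sum.elim_inl, Sum.elim_inr] <;> fun_prop
    have := IsProjective.exists (X := (α → ℕ → ℕ) × (Fin n → ℕ → ℕ)) (P := fun z a =>
      t₁.realize (fun i => dec (Sum.elim z.1 z.2 i)) = dec a ∧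
      t₂.realize (fun i => dec (Sum.elim z.1 z.2 i)) = dec a)
      (((h.term t₁).comp hc).and ((h.term t₂).comp hc))
    refine (congrArg IsProjective ?_).mp this
    ext q
    have he : (fun i => dec (Sum.elim q.1 q.2 i)) =
        Sum.elim (fun i => dec (q.1 i)) (fun i => dec (q.2 i)) := by
      ext (i | i) <;> rfl
    change (∃ a, _) ↔ t₁.realize (Sum.elim (fun i => dec (q.1 i)) (fun i => dec (q.2 i))) =
      t₂.realize (Sum.elim (fun i => dec (q.1 i)) (fun i => dec (q.2 i)))
    rw [← he]
    constructor
    · rintro ⟨a, ha, hb⟩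
      rw [ha, hb]
    · intro hq
      obtain ⟨a, ha⟩ := h.surjective (t₁.realize (fun i => dec (Sum.elim q.1 q.2 i)))
      exact ⟨a, ha.symm, hq ▸ ha.symm⟩
  | rel R => exact Empty.elim R
  | imp φ ψ ih₁ ih₂ => exact ih₁.imp ih₂
  | @all n φ ih =>
    have := IsProjective.forall (X := (α → ℕ → ℕ) × (Fin n → ℕ → ℕ)) (P := fun q a =>
      φ.Realize (fun i => dec (q.1 i)) (fun i => dec ((Fin.snoc q.2 a : Fin (n + 1) → ℕ → ℕ) i)))
      (ih.comp (f := fun q : ((α → ℕ → ℕ) × (Fin n → ℕ → ℕ)) × (ℕ → ℕ) =>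
        (q.1.1, (Fin.snoc q.1.2 q.2 : Fin (n + 1) → ℕ → ℕ))) (by fun_prop))
    refine (congrArg IsProjective ?_).mp this
    ext q
    have hs : ∀ a, (fun i => dec ((Fin.snoc q.2 a : Fin (n + 1) → ℕ → ℕ) i)) =
        (Fin.snoc (fun i => dec (q.2 i)) (dec a) : Fin (n + 1) → G) := fun a =>
      Fin.comp_snoc dec q.2 a
    simp only [mem_ofPred_eq, Language.BoundedFormula.realize_all, hs]
    exact (h.surjective.forall (p := fun y => φ.Realize _ (Fin.snoc _ y))).symm

instance : Countable groupLanguage.Symbols := by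
  have h₁ : Countable (Σ l, groupLanguage.Functions l) := by
    have : ∀ l, Countable (groupLanguage.Functions l) := fun l => by
      have : Subsingleton (GroupFunc l) := ⟨by rintro (_ | _) (_ | _) <;> rfl⟩
      exact (inferInstance : Countable (GroupFunc l))
    infer_instance
  have h₂ : Countable (Σ l, groupLanguage.Relations l) :=
    (inferInstance : Countable (Σ _ : ℕ, Empty))
  exact (inferInstance : Countable ((Σ l, groupLanguage.Functions l) ⊕
    (Σ l, groupLanguage.Relations l)))

/-- Inner automorphisms preserve first-order truth. -/
theorem mem_tp_conj (k g : G) (φ : groupLanguage.Formula (Fin 1)) :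
    φ ∈ tp (k * g * k⁻¹) ↔ φ ∈ tp g := by
  let E : G ≃[groupLanguage] G :=
    { MulAut.conj k with
      map_fun' := by
        intro n f x
        cases f with
        | one => exact map_one (MulAut.conj k)
        | mul => exact map_mul (MulAut.conj k) (x 0) (x 1)
      map_rel' := fun r => Empty.elim r }
  exact Language.StrongHomClass.realize_formula E φ (v := fun _ => g)

/-- Under PD, let `g` be a projective family of elements of a projectively coded group such that
the shifts of `x` give conjugates of `g x`, while the conjugacy classes are meagre. Then some
members of the family have the same type without being conjugate. -/
theorem exists_tp_eq_not_isConj (hPD : ProjectiveDeterminacy) (h : ProjectivelyCoded dec)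
    (g : (ℕ → ℕ) → G) (hg : IsProjective {q : (ℕ → ℕ) × (ℕ → ℕ) | dec q.2 = g q.1})
    (hconj : ∀ k x, ∃ c, g (shift k x) = c * g x * c⁻¹)
    (hmeagre : ∀ x, ∀ᶠ y in residual (ℕ → ℕ), ¬ IsConj (g x) (g y)) :
    ∃ x y, tp (g x) = tp (g y) ∧ ¬ IsConj (g x) (g y) := by
  have key : ∀ φ : groupLanguage.Formula (Fin 1), ∃ P : Prop,
      ∀ᶠ x in residual (ℕ → ℕ), φ ∈ tp (g x) ↔ P := by
    intro φ
    have hproj : IsProjective {x | φ ∈ tp (g x)} := by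
      have hφ : IsProjective {q : (ℕ → ℕ) × (ℕ → ℕ) | φ ∈ tp (dec q.2)} := by
        have := (h.boundedFormula φ).comp (f := fun q : (ℕ → ℕ) × (ℕ → ℕ) =>
          ((fun _ => q.2 : Fin 1 → ℕ → ℕ), (default : Fin 0 → ℕ → ℕ))) (by fun_prop)
        refine (congrArg IsProjective ?_).mp this
        ext q
        rw [mem_ofPred_eq, mem_ofPred_eq, tp, mem_ofPred_eq, Language.Formula.Realize]
        exact iff_of_eq (congrArg _ (Subsingleton.elim _ _))
      have := IsProjective.exists (X := ℕ → ℕ) (P := fun x a => dec a = g x ∧ φ ∈ tp (dec a))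
        (hg.and hφ)
      refine (congrArg IsProjective ?_).mp this
      ext x
      constructor
      · rintro ⟨a, ha, haφ⟩
        rwa [mem_ofPred_eq, ← ha]
      · intro hx
        obtain ⟨a, ha⟩ := h.surjective (g x)
        exact ⟨a, ha, by rwa [ha]⟩
    have hinv : ∀ k x, shift k x ∈ {x | φ ∈ tp (g x)} → x ∈ {x | φ ∈ tp (g x)} := by
      intro k x hx
      obtain ⟨c, hc⟩ := hconj k x
      rw [mem_ofPred_eq, hc, mem_tp_conj] at hx
      exact hx
    rcases hproj.zero_one hPD hinv with h | h
    · exact ⟨True, h.mono fun x hx => iff_true_intro hx⟩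
    · exact ⟨False, h.mono fun x hx => iff_false_intro hx⟩
  choose P hP using key
  -- The language is countable, so a generic `x` decides all formulas in the generic way at once.
  have hall := eventually_countable_forall.2 hP
  obtain ⟨x, hx⟩ := (dense_of_mem_residual hall).nonempty
  obtain ⟨y, hy, hxy⟩ := (dense_of_mem_residual (hall.and (hmeagre x))).nonempty
  exact ⟨x, y, Set.ext fun φ => (hx φ).trans (hy φ).symm, hxy⟩

end Coded

end HomeoTypes
namespace HomeoTypes

open Set Filter Topology TopologicalSpace

/-! ### Coding homeomorphisms by sequences -/

section Coding

variable {M : Type*} [TopologicalSpace M]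

/-- Let `U` enumerate a basis of `M`. The sequence `S` codes the relation on `M` that holds between
`p` and `q` if the sets `U m` containing `q` are exactly those for which `p` lies in some `U n` with
`S (Nat.pair n m) = 0`. -/
def CodeRel (U : ℕ → Set M) (S : ℕ → ℕ) (p q : M) : Prop :=
  ∀ m, q ∈ U m ↔ ∃ n, S (Nat.pair n m) = 0 ∧ p ∈ U n

variable {U : ℕ → Set M}

theorem CodeRel.unique [T0Space M] (hU : IsTopologicalBasis (range U)) {S : ℕ → ℕ} {p q q' : M}
    (h : CodeRel U S p q) (h' : CodeRel U S p q') : q = q' :=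
  hU.eq_iff.2 (by rintro _ ⟨m, rfl⟩; rw [h m, h' m])

theorem continuous_of_codeRel (hU : IsTopologicalBasis (range U)) {S : ℕ → ℕ} {f : M → M}
    (h : ∀ p, CodeRel U S p (f p)) : Continuous f := by
  refine hU.continuous_iff.2 ?_
  rintro _ ⟨m, rfl⟩
  have : f ⁻¹' U m = ⋃ n, ⋃ _ : S (Nat.pair n m) = 0, U n := by
    ext p
    simp [h p m]
  rw [this]
  exact isOpen_iUnion fun n => isOpen_iUnion fun _ => hU.isOpen (mem_range_self n)

/-- The code records which basic sets `f` maps into which; continuity makes this enough to recover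
`f`. -/
theorem exists_codeRel (hU : IsTopologicalBasis (range U)) {f : M → M} (hf : Continuous f) :
    ∃ S : ℕ → ℕ, ∀ p, CodeRel U S p (f p) := by
  classical
  refine ⟨fun k => if MapsTo f (U k.unpair.1) (U k.unpair.2) then 0 else 1, fun p m => ?_⟩
  simp only [Nat.unpair_pair, ite_eq_left_iff, one_ne_zero, imp_false, not_not]
  constructor
  · intro hp
    obtain ⟨_, ⟨n, rfl⟩, hpn, hn⟩ := hU.exists_subset_of_mem_open (show p ∈ f ⁻¹' U m from hp)
      ((hU.isOpen (mem_range_self m)).preimage hf)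
    exact ⟨n, hn, hpn⟩
  · rintro ⟨n, hn, hp⟩
    exact hn hp

/-- The sequence `S` codes a homeomorphism. -/
def IsCode (U : ℕ → Set M) (S : ℕ → ℕ) : Prop :=
  ∃ g : M ≃ₜ M, ∀ p, CodeRel U S p (g p)

open Classical in
/-- The homeomorphism coded by a sequence; sequences that do not code a homeomorphism stand for
the identity. -/
noncomputable def decode (U : ℕ → Set M) (S : ℕ → ℕ) : M ≃ₜ M :=
  if h : IsCode U S then h.choose else 1

theorem decode_apply_eq_iff [T0Space M] (hU : IsTopologicalBasis (range U)) {S : ℕ → ℕ} {p q : M} :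
    decode U S p = q ↔ IsCode U S ∧ CodeRel U S p q ∨ ¬ IsCode U S ∧ p = q := by
  by_cases h : IsCode U S
  · simp only [decode, h, dite_true, true_and, not_true_eq_false, false_and, or_false]
    exact ⟨fun hq => hq ▸ h.choose_spec p, fun hq => (h.choose_spec p).unique hU hq⟩
  · simp only [decode, h, dite_false, false_and, not_false_eq_true, true_and, false_or]
    rfl

theorem decode_eq [T0Space M] (hU : IsTopologicalBasis (range U)) {S : ℕ → ℕ} {g : M ≃ₜ M}
    (h : ∀ p, CodeRel U S p (g p)) : decode U S = g := by
  ext p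
  exact (decode_apply_eq_iff hU).2 (Or.inl ⟨⟨g, h⟩, h p⟩)

theorem decode_surjective [T0Space M] (hU : IsTopologicalBasis (range U)) :
    Function.Surjective (decode U) := fun g =>
  let ⟨S, hS⟩ := exists_codeRel hU g.continuous
  ⟨S, decode_eq hU hS⟩

/-- This replaces the quantifier over homeomorphisms by quantifiers over sequences and points: `S'`
codes the inverse, and maps given by codes are automatically continuous. -/
theorem isCode_iff [T0Space M] (hU : IsTopologicalBasis (range U)) {S : ℕ → ℕ} :
    IsCode U S ↔ ∃ S', (∀ p, ∃ q, CodeRel U S p q) ∧ (∀ q, ∃ p, CodeRel U S' q p) ∧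
      ∀ p q, CodeRel U S p q ↔ CodeRel U S' q p := by
  constructor
  · rintro ⟨g, hg⟩
    obtain ⟨S', hS'⟩ := exists_codeRel hU g.symm.continuous
    refine ⟨S', fun p => ⟨_, hg p⟩, fun q => ⟨_, hS' q⟩, fun p q => ⟨fun h => ?_, fun h => ?_⟩⟩
    · rw [h.unique hU (hg p)]
      simpa using hS' (g p)
    · rw [h.unique hU (hS' q)]
      simpa using hg (g.symm q)
  · rintro ⟨S', h₁, h₂, h₃⟩
    choose f hf using h₁
    choose f' hf' using h₂
    exact ⟨{ toFun := f
             invFun := f'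
             left_inv := fun p => (hf' (f p)).unique hU ((h₃ _ _).1 (hf p))
             right_inv := fun q => (hf (f' q)).unique hU ((h₃ _ _).2 (hf' q))
             continuous_toFun := continuous_of_codeRel hU hf
             continuous_invFun := continuous_of_codeRel hU hf' }, hf⟩

variable {π : (ℕ → ℕ) → M}

/-- With points parametrised by `π`, the relation is Borel: it combines open and closed conditions
by quantifiers over `ℕ`. -/
theorem isProjective_codeRel (hU : IsTopologicalBasis (range U)) (hπ : Continuous π) :
    IsProjective {q : (ℕ → ℕ) × (ℕ → ℕ) × (ℕ → ℕ) | CodeRel U q.1 (π q.2.1) (π q.2.2)} := by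
  borelize ((ℕ → ℕ) × (ℕ → ℕ) × (ℕ → ℕ))
  refine isProjective_of_measurableSet (measurableSet_setOfPred.2 ?_)
  have hm : ∀ {f : (ℕ → ℕ) × (ℕ → ℕ) × (ℕ → ℕ) → M}, Continuous f → ∀ n,
      Measurable fun q => f q ∈ U n := fun hf n =>
    measurableSet_setOfPred.1 ((hU.isOpen (mem_range_self n)).preimage hf).measurableSet
  refine Measurable.forall fun m => (hm (f := fun q => π q.2.2) (by fun_prop) m).iff
    (Measurable.exists fun n => Measurable.and (measurableSet_setOfPred.1 ?_)
      (hm (f := fun q => π q.2.1) (by fun_prop) n))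
  exact (isClosed_eq (f := fun q : (ℕ → ℕ) × (ℕ → ℕ) × (ℕ → ℕ) => q.1 (Nat.pair n m))
    (by fun_prop) continuous_const).measurableSet

theorem isProjective_isCode [T0Space M] (hU : IsTopologicalBasis (range U)) (hπ : Continuous π)
    (hs : Function.Surjective π) : IsProjective {S : ℕ → ℕ | IsCode U S} := by
  simp only [isCode_iff hU, hs.forall, hs.exists]
  have h := isProjective_codeRel hU hπ
  refine IsProjective.exists (.and ?_ (.and ?_ ?_))
  · exact .forall <| .exists <| h.comp
      (f := fun q : (((ℕ → ℕ) × (ℕ → ℕ)) × (ℕ → ℕ)) × (ℕ → ℕ) => (q.1.1.1, q.1.2, q.2))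
      (by fun_prop)
  · exact .forall <| .exists <| h.comp
      (f := fun q : (((ℕ → ℕ) × (ℕ → ℕ)) × (ℕ → ℕ)) × (ℕ → ℕ) => (q.1.1.2, q.1.2, q.2))
      (by fun_prop)
  · exact .forall <| .forall <| .iff (h.comp
      (f := fun q : (((ℕ → ℕ) × (ℕ → ℕ)) × (ℕ → ℕ)) × (ℕ → ℕ) => (q.1.1.1, q.1.2, q.2))
      (by fun_prop)) (h.comp
      (f := fun q : (((ℕ → ℕ) × (ℕ → ℕ)) × (ℕ → ℕ)) × (ℕ → ℕ) => (q.1.1.2, q.2, q.1.2))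
      (by fun_prop))

theorem isProjective_decode_apply [T2Space M] (hU : IsTopologicalBasis (range U))
    (hπ : Continuous π) (hs : Function.Surjective π) :
    IsProjective {q : (ℕ → ℕ) × (ℕ → ℕ) × (ℕ → ℕ) | decode U q.1 (π q.2.1) = π q.2.2} := by
  simp only [decode_apply_eq_iff hU]
  have hc := (isProjective_isCode hU hπ hs).comp
    (f := fun q : (ℕ → ℕ) × (ℕ → ℕ) × (ℕ → ℕ) => q.1) continuous_fst
  exact (hc.and (isProjective_codeRel hU hπ)).or
    (hc.not.and (isProjective_of_isClosed (isClosed_eq (by fun_prop) (by fun_prop))))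

/-- A jointly continuous family of homeomorphisms is projective in the codes. -/
theorem isProjective_decode_eq [T2Space M] (hU : IsTopologicalBasis (range U))
    (hπ : Continuous π) (hs : Function.Surjective π) {g : (ℕ → ℕ) → M ≃ₜ M}
    (hg : Continuous fun q : (ℕ → ℕ) × M => g q.1 q.2) :
    IsProjective {q : (ℕ → ℕ) × (ℕ → ℕ) | decode U q.2 = g q.1} := by
  have h := isProjective_decode_apply hU hπ hs
  have : IsProjective {q : (ℕ → ℕ) × (ℕ → ℕ) |
      -- Two homeomorphisms are equal if and only if their graphs agree on all parametrised points.
      ∀ a b, decode U q.2 (π a) = π b ↔ g q.1 (π a) = π b} := by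
    refine .forall <| .forall <| .iff (h.comp
      (f := fun q : (((ℕ → ℕ) × (ℕ → ℕ)) × (ℕ → ℕ)) × (ℕ → ℕ) => (q.1.1.2, q.1.2, q.2))
      (by fun_prop)) (isProjective_of_isClosed (isClosed_eq ?_ ?_))
    · exact hg.comp (f := fun q : (((ℕ → ℕ) × (ℕ → ℕ)) × (ℕ → ℕ)) × (ℕ → ℕ) =>
        (q.1.1.1, π q.1.2)) (by fun_prop)
    · fun_prop
  refine (congrArg IsProjective ?_).mp this
  ext q
  constructor
  · intro hq
    ext p
    obtain ⟨a, rfl⟩ := hs p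
    obtain ⟨b, hb⟩ := hs (g q.1 (π a))
    rw [(hq a b).2 hb.symm, hb]
  · intro hq a b
    rw [show decode U q.2 = g q.1 from hq]

/-- The homeomorphism group of a second countable Hausdorff space that is a continuous image of
Baire space is projectively coded. -/
theorem projectivelyCoded_decode [T2Space M] (hU : IsTopologicalBasis (range U))
    (hπ : Continuous π) (hs : Function.Surjective π) : ProjectivelyCoded (decode U) := by
  have h := isProjective_decode_apply hU hπ hs
  refine ⟨decode_surjective hU, ?_, ?_, ?_⟩
  · have : IsProjective {q : (ℕ → ℕ) × (ℕ → ℕ) |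
        ∀ a b, decode U q.1 (π a) = π b ↔ decode U q.2 (π a) = π b} :=
      .forall <| .forall <| .iff (h.comp
        (f := fun q : (((ℕ → ℕ) × (ℕ → ℕ)) × (ℕ → ℕ)) × (ℕ → ℕ) => (q.1.1.1, q.1.2, q.2))
        (by fun_prop)) (h.comp
        (f := fun q : (((ℕ → ℕ) × (ℕ → ℕ)) × (ℕ → ℕ)) × (ℕ → ℕ) => (q.1.1.2, q.1.2, q.2))
        (by fun_prop))
    refine (congrArg IsProjective ?_).mp this
    ext q
    constructor
    · intro hq
      ext p
      obtain ⟨a, rfl⟩ := hs p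
      obtain ⟨b, hb⟩ := hs (decode U q.2 (π a))
      rw [(hq a b).2 hb.symm, hb]
    · intro hq a b
      rw [show decode U q.1 = decode U q.2 from hq]
  · have h := isProjective_decode_eq hU hπ hs (g := fun _ => 1) continuous_snd
    exact h.comp (f := fun a : ℕ → ℕ => (a, a)) (by fun_prop)
  · have : IsProjective {q : (ℕ → ℕ) × (ℕ → ℕ) × (ℕ → ℕ) |
        ∀ a b c, decode U q.2.1 (π a) = π b → decode U q.1 (π b) = π c →
          decode U q.2.2 (π a) = π c} :=
      .forall <| .forall <| .forall <| .imp (h.comp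
        (f := fun q : ((((ℕ → ℕ) × (ℕ → ℕ) × (ℕ → ℕ)) × (ℕ → ℕ)) × (ℕ → ℕ)) × (ℕ → ℕ) =>
          (q.1.1.1.2.1, q.1.1.2, q.1.2)) (by fun_prop)) <| .imp (h.comp
        (f := fun q : ((((ℕ → ℕ) × (ℕ → ℕ) × (ℕ → ℕ)) × (ℕ → ℕ)) × (ℕ → ℕ)) × (ℕ → ℕ) =>
          (q.1.1.1.1, q.1.2, q.2)) (by fun_prop)) (h.comp
        (f := fun q : ((((ℕ → ℕ) × (ℕ → ℕ) × (ℕ → ℕ)) × (ℕ → ℕ)) × (ℕ → ℕ)) × (ℕ → ℕ) =>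
          (q.1.1.1.2.2, q.1.1.2, q.2)) (by fun_prop))
    refine (congrArg IsProjective ?_).mp this
    ext q
    constructor
    · intro hq
      ext p
      obtain ⟨a, rfl⟩ := hs p
      obtain ⟨b, hb⟩ := hs (decode U q.2.1 (π a))
      obtain ⟨c, hc⟩ := hs (decode U q.1 (π b))
      rw [hq a b c hb.symm hc.symm, hc, hb]
      rfl
    · intro hq a b c hb hc
      rw [← show decode U q.1 * decode U q.2.1 = decode U q.2.2 from hq, ← hc, ← hb]
      rfl

end Coding

end HomeoTypes
namespace HomeoTypes

open Set Filter Topology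

/-! ### Homeomorphisms of the line that fix the integers -/

/-- The map of the line that fixes the integers and moves the points of the interval `[n, n + 1]` in
the direction given by the sign of `a n`. -/
noncomputable def wobble (a : ℤ → ℝ) (t : ℝ) : ℝ :=
  t + a ⌊t⌋ * (Int.fract t * (1 - Int.fract t))

/-- The added term vanishes at both end points, so the formula holds on the closed interval;
continuity then follows by gluing. -/
theorem wobble_eq (a : ℤ → ℝ) {n : ℤ} {t : ℝ} (h : t ∈ Icc (n : ℝ) (n + 1)) :
    wobble a t = t + a n * ((t - n) * (n + 1 - t)) := by
  rcases h.2.lt_or_eq with h' | rfl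
  · have : ⌊t⌋ = n := Int.floor_eq_iff.2 ⟨h.1, h'⟩
    rw [wobble, Int.fract, this]
    ring
  · have : Int.fract ((n : ℝ) + 1) = 0 := by
      rw [show (n : ℝ) + 1 = ((n + 1 : ℤ) : ℝ) by push_cast; ring, Int.fract_intCast]
    simp [wobble, this]

theorem mem_Icc_floor (t : ℝ) : t ∈ Icc (⌊t⌋ : ℝ) (⌊t⌋ + 1) :=
  ⟨Int.floor_le t, (Int.lt_floor_add_one t).le⟩

theorem wobble_intCast (a : ℤ → ℝ) (n : ℤ) : wobble a n = n := by
  simp [wobble]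

theorem wobble_add_intCast (a : ℤ → ℝ) (t : ℝ) (k : ℤ) :
    wobble a (t + k) = wobble (fun n => a (n + k)) t + k := by
  simp [wobble]
  ring

theorem locallyFinite_Icc_intCast : LocallyFinite fun n : ℤ => Icc (n : ℝ) (n + 1) := by
  intro t
  refine ⟨Ioo (t - 1) (t + 1), Ioo_mem_nhds (by linarith) (by linarith),
    (finite_Icc (⌊t⌋ - 2) (⌊t⌋ + 2)).subset ?_⟩
  rintro n ⟨s, ⟨h₁, h₂⟩, h₃, h₄⟩
  have h₅ := Int.floor_le t
  have h₆ := Int.lt_floor_add_one t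
  constructor
  · have : ((⌊t⌋ - 2 : ℤ) : ℝ) < n := by push_cast; linarith
    exact_mod_cast this.le
  · have : (n : ℝ) < ((⌊t⌋ + 2 : ℤ) : ℝ) := by push_cast; linarith
    exact_mod_cast this.le

theorem continuous_wobble : Continuous fun q : (ℤ → ℝ) × ℝ => wobble q.1 q.2 := by
  refine (locallyFinite_Icc_intCast.preimage_continuous
    (continuous_snd : Continuous (Prod.snd : (ℤ → ℝ) × ℝ → ℝ))).continuous
      (iUnion_eq_univ_iff.2 fun q => ⟨_, mem_Icc_floor q.2⟩)
      (fun n => isClosed_Icc.preimage continuous_snd) fun n => ?_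
  refine ContinuousOn.congr (f := fun q : (ℤ → ℝ) × ℝ =>
    q.2 + q.1 n * ((q.2 - n) * (n + 1 - q.2))) (by fun_prop) fun q hq => wobble_eq q.1 hq

theorem abs_wobble_sub_le {a : ℤ → ℝ} (ha : ∀ n, |a n| ≤ 1 / 2) (t : ℝ) :
    |wobble a t - t| ≤ 1 := by
  have h₀ := Int.fract_nonneg t
  have h₁ := (Int.fract_lt_one t).le
  rw [wobble, add_sub_cancel_left, abs_mul, abs_of_nonneg (mul_nonneg h₀ (sub_nonneg.2 h₁))]
  calc |a ⌊t⌋| * (Int.fract t * (1 - Int.fract t)) ≤ 1 / 2 * 1 := by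
        refine mul_le_mul (ha _) ?_ (mul_nonneg h₀ (sub_nonneg.2 h₁)) (by norm_num)
        nlinarith
    _ ≤ 1 := by norm_num

theorem wobble_mem_Ico {a : ℤ → ℝ} (ha : ∀ n, |a n| ≤ 1 / 2) {n : ℤ} {t : ℝ}
    (ht : t ∈ Ico (n : ℝ) (n + 1)) : wobble a t ∈ Ico (n : ℝ) (n + 1) := by
  rw [wobble_eq a (Ico_subset_Icc_self ht)]
  have h₁ := abs_le.1 (ha n)
  have h₂ := sub_nonneg.2 ht.1
  have h₃ := sub_pos.2 ht.2
  constructor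
  · nlinarith [mul_nonneg h₂ h₃.le]
  · nlinarith [mul_nonneg h₂ h₃.le]

theorem strictMono_wobble {a : ℤ → ℝ} (ha : ∀ n, |a n| ≤ 1 / 2) : StrictMono (wobble a) := by
  intro s t hst
  have hs := wobble_mem_Ico ha (n := ⌊s⌋) ⟨Int.floor_le s, Int.lt_floor_add_one s⟩
  have ht := wobble_mem_Ico ha (n := ⌊t⌋) ⟨Int.floor_le t, Int.lt_floor_add_one t⟩
  rcases (Int.floor_mono hst.le).lt_or_eq with h | h
  · have : ((⌊s⌋ + 1 : ℤ) : ℝ) ≤ ⌊t⌋ := by exact_mod_cast h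
    push_cast at this
    linarith [hs.2, ht.1]
  · have hs' := mem_Icc_floor s
    have ht' := mem_Icc_floor t
    rw [← h] at ht'
    rw [wobble_eq a hs', wobble_eq a ht']
    have h₁ := abs_le.1 (ha ⌊s⌋)
    -- This product is `wobble a t - wobble a s`. Its second factor is at least `1 / 2`, by the
    -- bound on `a`.
    have : 0 < (t - s) * (1 + a ⌊s⌋ * (1 - (s - ⌊s⌋) - (t - ⌊s⌋))) := by
      refine mul_pos (sub_pos.2 hst) ?_
      have h₂ : |a ⌊s⌋ * (1 - (s - ⌊s⌋) - (t - ⌊s⌋))| ≤ 1 / 2 * 1 := by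
        rw [abs_mul]
        refine mul_le_mul (ha _) (abs_le.2 ⟨?_, ?_⟩) (abs_nonneg _) (by norm_num)
        · linarith [hs'.2, ht'.2]
        · linarith [hs'.1, ht'.1]
      linarith [(abs_le.1 h₂).1]
    nlinarith

theorem surjective_of_abs_sub_le {F : ℝ → ℝ} (hF : Continuous F) {C : ℝ}
    (h : ∀ t, |F t - t| ≤ C) : Function.Surjective F := by
  refine hF.surjective ?_ ?_
  · refine tendsto_atTop_mono (f := fun t => t - C) (fun t => ?_)
      (tendsto_atTop_add_const_right _ _ tendsto_id)
    linarith [(abs_le.1 (h t)).1]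
  · refine tendsto_atBot_mono (f := fun t => t + C) (fun t => ?_)
      (tendsto_atBot_add_const_right _ _ tendsto_id)
    linarith [(abs_le.1 (h t)).2]

/-- The map `wobble a` as a homeomorphism. -/
noncomputable def wobbleHomeo (a : ℤ → ℝ) (ha : ∀ n, |a n| ≤ 1 / 2) : ℝ ≃ₜ ℝ :=
  ((strictMono_wobble ha).orderIsoOfSurjective _ (surjective_of_abs_sub_le
    (continuous_wobble.comp (Continuous.prodMk_right a)) (abs_wobble_sub_le ha))).toHomeomorph

theorem wobbleHomeo_apply (a : ℤ → ℝ) (ha : ∀ n, |a n| ≤ 1 / 2) (t : ℝ) :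
    wobbleHomeo a ha t = wobble a t := rfl

/-- Iterates converge to an end point of an interval without fixed points. -/
theorem tendsto_iterate_right {h : ℝ → ℝ} (hc : Continuous h) {l r : ℝ}
    (hm : ∀ t ∈ Ioo l r, h t ∈ Ioo l r ∧ t < h t) {t : ℝ} (ht : t ∈ Ioo l r) :
    Tendsto (fun j => h^[j] t) atTop (𝓝 r) := by
  have hmem : ∀ j, h^[j] t ∈ Ioo l r := fun j => by
    induction j with
    | zero => exact ht
    | succ j ih => rw [Function.iterate_succ_apply']; exact (hm _ ih).1
  have hmono : Monotone fun j => h^[j] t := monotone_nat_of_le_succ fun j => by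
    rw [Function.iterate_succ_apply']
    exact (hm _ (hmem j)).2.le
  have hlim := tendsto_atTop_ciSup hmono ⟨r, by rintro _ ⟨j, rfl⟩; exact (hmem j).2.le⟩
  set L := ⨆ j, h^[j] t
  have hfix : h L = L := isFixedPt_of_tendsto_iterate hlim hc.continuousAt
  have hLr : L ≤ r := le_of_tendsto' hlim fun j => (hmem j).2.le
  have htL : t ≤ L := ge_of_tendsto' hlim fun j => hmono (Nat.zero_le j)
  rcases hLr.lt_or_eq with h' | h'
  · exact absurd hfix (hm L ⟨ht.1.trans_le htL, h'⟩).2.ne'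
  · rwa [h'] at hlim

theorem tendsto_iterate_left {h : ℝ → ℝ} (hc : Continuous h) {l r : ℝ}
    (hm : ∀ t ∈ Ioo l r, h t ∈ Ioo l r ∧ h t < t) {t : ℝ} (ht : t ∈ Ioo l r) :
    Tendsto (fun j => h^[j] t) atTop (𝓝 l) := by
  -- Reflecting the line reduces the claim to the other direction.
  have hsemi : Function.Semiconj (fun s : ℝ => -s) h fun s => -h (-s) := fun s => by simp
  have := tendsto_iterate_right (h := fun s => -h (-s)) (l := -r) (r := -l) (by fun_prop)
    (fun s hs => by
      obtain ⟨⟨h₁, h₂⟩, h₃⟩ := hm (-s) ⟨by linarith [hs.2], by linarith [hs.1]⟩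
      exact ⟨⟨by linarith, by linarith⟩, by linarith⟩)
    (t := -t) ⟨by linarith [ht.2], by linarith [ht.1]⟩
  have := this.neg
  simp only [neg_neg] at this
  refine this.congr fun j => ?_
  rw [← (hsemi.iterate_right j).eq t, neg_neg]

theorem wobbleHomeo_mem_Ioo {a : ℤ → ℝ} (ha : ∀ n, |a n| ≤ 1 / 2) {n : ℤ} {t : ℝ} :
    wobbleHomeo a ha t ∈ Ioo (n : ℝ) (n + 1) ↔ t ∈ Ioo (n : ℝ) (n + 1) := by
  have h := strictMono_wobble ha
  have h₁ := wobble_intCast a n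
  have h₂ := wobble_intCast a (n + 1)
  push_cast at h₂
  rw [wobbleHomeo_apply, mem_Ioo, mem_Ioo, ← h.lt_iff_lt (a := (n : ℝ)) (b := t),
    ← h.lt_iff_lt (a := t) (b := (n : ℝ) + 1), h₁, h₂]

theorem wobbleHomeo_symm_mem_Ioo {a : ℤ → ℝ} (ha : ∀ n, |a n| ≤ 1 / 2) {n : ℤ} {t : ℝ} :
    (wobbleHomeo a ha).symm t ∈ Ioo (n : ℝ) (n + 1) ↔ t ∈ Ioo (n : ℝ) (n + 1) := by
  rw [← wobbleHomeo_mem_Ioo ha, Homeomorph.apply_symm_apply]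

theorem lt_wobble_iff {a : ℤ → ℝ} {n : ℤ} {t : ℝ} (ht : t ∈ Ioo (n : ℝ) (n + 1)) :
    t < wobble a t ↔ 0 < a n := by
  rw [wobble_eq a (Ioo_subset_Icc_self ht), lt_add_iff_pos_right]
  exact mul_pos_iff_of_pos_right (mul_pos (sub_pos.2 ht.1) (sub_pos.2 ht.2))

theorem wobble_lt_iff {a : ℤ → ℝ} {n : ℤ} {t : ℝ} (ht : t ∈ Ioo (n : ℝ) (n + 1)) :
    wobble a t < t ↔ a n < 0 := by
  have : 0 < (t - n) * (n + 1 - t) := mul_pos (sub_pos.2 ht.1) (sub_pos.2 ht.2)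
  rw [wobble_eq a (Ioo_subset_Icc_self ht)]
  constructor
  · intro h
    by_contra! h'
    nlinarith [mul_nonneg h' this.le]
  · intro h
    nlinarith [mul_pos_of_neg_of_neg h (neg_lt_zero.2 this)]

theorem tendsto_wobble_of_pos {a : ℤ → ℝ} (ha : ∀ n, |a n| ≤ 1 / 2) {n : ℤ} (hn : 0 < a n) {t : ℝ}
    (ht : t ∈ Ioo (n : ℝ) (n + 1)) :
    Tendsto (fun j => (wobbleHomeo a ha)^[j] t) atTop (𝓝 (n + 1)) ∧
      Tendsto (fun j => (wobbleHomeo a ha).symm^[j] t) atTop (𝓝 n) := by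
  refine ⟨tendsto_iterate_right (wobbleHomeo a ha).continuous (fun s hs =>
    ⟨(wobbleHomeo_mem_Ioo ha).2 hs, (lt_wobble_iff hs).2 hn⟩) ht,
    tendsto_iterate_left (wobbleHomeo a ha).symm.continuous (fun s hs =>
    ⟨(wobbleHomeo_symm_mem_Ioo ha).2 hs, ?_⟩) ht⟩
  have := (lt_wobble_iff ((wobbleHomeo_symm_mem_Ioo ha).2 hs)).2 hn
  rwa [← wobbleHomeo_apply a ha, Homeomorph.apply_symm_apply] at this

theorem tendsto_wobble_of_neg {a : ℤ → ℝ} (ha : ∀ n, |a n| ≤ 1 / 2) {n : ℤ} (hn : a n < 0) {t : ℝ}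
    (ht : t ∈ Ioo (n : ℝ) (n + 1)) :
    Tendsto (fun j => (wobbleHomeo a ha)^[j] t) atTop (𝓝 n) ∧
      Tendsto (fun j => (wobbleHomeo a ha).symm^[j] t) atTop (𝓝 (n + 1)) := by
  refine ⟨tendsto_iterate_left (wobbleHomeo a ha).continuous (fun s hs =>
    ⟨(wobbleHomeo_mem_Ioo ha).2 hs, (wobble_lt_iff hs).2 hn⟩) ht,
    tendsto_iterate_right (wobbleHomeo a ha).symm.continuous (fun s hs =>
    ⟨(wobbleHomeo_symm_mem_Ioo ha).2 hs, ?_⟩) ht⟩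
  have := (wobble_lt_iff ((wobbleHomeo_symm_mem_Ioo ha).2 hs)).2 hn
  rwa [← wobbleHomeo_apply a ha, Homeomorph.apply_symm_apply] at this

end HomeoTypes
namespace HomeoTypes

open Set Filter Topology Real

/-! ### Radial homeomorphisms of a ball -/

/-- The inverse of the sigmoid function. -/
noncomputable def logit (r : ℝ) : ℝ := log (r / (1 - r))

theorem logit_sigmoid (t : ℝ) : logit (sigmoid t) = t := by
  have h : sigmoid t / (1 - sigmoid t) = exp t := by
    rw [← sigmoid_neg, ← sigmoid_mul_rexp_neg, exp_neg]
    have := sigmoid_pos t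
    field_simp
  rw [logit, h, log_exp]

theorem sigmoid_logit {r : ℝ} (h₀ : 0 < r) (h₁ : r < 1) : sigmoid (logit r) = r := by
  obtain ⟨t, rfl⟩ : r ∈ range sigmoid := by rw [range_sigmoid]; exact ⟨h₀, h₁⟩
  rw [logit_sigmoid]

theorem sigmoid_le_exp_mul {s t C : ℝ} (h : |s - t| ≤ C) : sigmoid s ≤ exp C * sigmoid t := by
  rw [sigmoid_def, sigmoid_def, ← div_eq_mul_inv, inv_eq_one_div,
    div_le_div_iff₀ (by positivity) (by positivity), one_mul, mul_add, ← exp_add, mul_one]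
  have h' := abs_le.1 h
  exact add_le_add (one_le_exp ((abs_nonneg _).trans h)) (exp_le_exp.2 (by linarith))

variable {E : Type*} [NormedAddCommGroup E] [NormedSpace ℝ E]

/-- The map of `E` that fixes the origin and the complement of the unit ball and acts through `F` on
the radius `r = sigmoid t` of the other points. -/
noncomputable def radial (F : ℝ → ℝ) (p : E) : E :=
  if 0 < ‖p‖ ∧ ‖p‖ < 1 then (sigmoid (F (logit ‖p‖)) / ‖p‖) • p else p

theorem radial_of_one_le (F : ℝ → ℝ) {p : E} (h : 1 ≤ ‖p‖) : radial F p = p :=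
  if_neg fun h' => h'.2.not_ge h

theorem norm_sigmoid_smul {u : E} (hu : ‖u‖ = 1) (t : ℝ) : ‖sigmoid t • u‖ = sigmoid t := by
  rw [norm_smul, hu, mul_one, norm_of_nonneg (sigmoid_nonneg t)]

theorem radial_sigmoid_smul (F : ℝ → ℝ) {u : E} (hu : ‖u‖ = 1) (t : ℝ) :
    radial F (sigmoid t • u) = sigmoid (F t) • u := by
  rw [radial, norm_sigmoid_smul hu, if_pos ⟨sigmoid_pos t, sigmoid_lt_one t⟩, logit_sigmoid,
    smul_smul, div_mul_cancel₀ _ (sigmoid_pos t).ne']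

theorem exists_eq_sigmoid_smul {p : E} (h₀ : 0 < ‖p‖) (h₁ : ‖p‖ < 1) :
    ∃ (u : E) (t : ℝ), ‖u‖ = 1 ∧ p = sigmoid t • u := by
  refine ⟨‖p‖⁻¹ • p, logit ‖p‖, ?_, ?_⟩
  · rw [norm_smul, norm_inv, norm_norm, inv_mul_cancel₀ h₀.ne']
  · rw [sigmoid_logit h₀ h₁, smul_smul, mul_inv_cancel₀ h₀.ne', one_smul]

theorem radial_cases (p : E) :
    (∃ (u : E) (t : ℝ), ‖u‖ = 1 ∧ p = sigmoid t • u) ∨ ∀ F, radial F p = p := by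
  by_cases h : 0 < ‖p‖ ∧ ‖p‖ < 1
  · exact Or.inl (exists_eq_sigmoid_smul h.1 h.2)
  · exact Or.inr fun F => if_neg h

theorem norm_radial_le (F : ℝ → ℝ) {p : E} (hp : ‖p‖ ≤ 1) : ‖radial F p‖ ≤ 1 := by
  rcases radial_cases p with ⟨u, t, hu, rfl⟩ | h
  · rw [radial_sigmoid_smul _ hu, norm_sigmoid_smul hu]
    exact sigmoid_le_one _
  · rwa [h]

/-- The first bound gives continuity at the origin, the second at the unit sphere and beyond. They
correspond under `t ↦ -t`, since `1 - sigmoid t = sigmoid (-t)`. -/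
theorem norm_radial_sub_le {F : ℝ → ℝ} {C : ℝ} (hF : ∀ t, |F t - t| ≤ C) (p : E) :
    ‖radial F p - p‖ ≤ exp C * ‖p‖ ∧ ‖radial F p - p‖ ≤ exp C * max 0 (1 - ‖p‖) := by
  rcases radial_cases p with ⟨u, t, hu, rfl⟩ | h
  · rw [radial_sigmoid_smul _ hu, ← sub_smul, norm_sigmoid_smul hu, norm_smul, hu, mul_one,
      norm_eq_abs, max_eq_right (sub_nonneg.2 (sigmoid_le_one t)), ← sigmoid_neg]
    have hC : 1 ≤ exp C := one_le_exp ((abs_nonneg _).trans (hF 0))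
    have h₁ := sigmoid_le_exp_mul (hF t)
    have h₂ : sigmoid (-F t) ≤ exp C * sigmoid (-t) := sigmoid_le_exp_mul (by
      rw [neg_sub_neg, abs_sub_comm]; exact hF t)
    have h₃ := sigmoid_pos t
    have h₄ := sigmoid_pos (F t)
    have h₅ := sigmoid_pos (-t)
    have h₆ := sigmoid_pos (-F t)
    have h₇ := sigmoid_neg t
    have h₈ := sigmoid_neg (F t)
    constructor <;> rw [abs_le] <;> constructor <;> nlinarith
  · rw [h, sub_self, norm_zero]
    exact ⟨by positivity, by positivity⟩

theorem continuous_radial {Y : Type*} [TopologicalSpace Y] {F : Y → ℝ → ℝ}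
    (hF : Continuous fun q : Y × ℝ => F q.1 q.2) {C : ℝ} (hC : ∀ y t, |F y t - t| ≤ C) :
    Continuous fun q : Y × E => radial (F q.1) q.2 := by
  have bound : ∀ (b : E → ℝ), Continuous b → (∀ y p, ‖radial (F y) p - p‖ ≤ b p) → ∀ y₀ p₀,
      b p₀ = 0 → ContinuousAt (fun q : Y × E => radial (F q.1) q.2) (y₀, p₀) := by
    intro b hb hle y₀ p₀ h₀
    have h₁ : Tendsto (fun q : Y × E => radial (F q.1) q.2 - q.2) (𝓝 (y₀, p₀)) (𝓝 0) := by
      refine squeeze_zero_norm (fun q => hle q.1 q.2) ?_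
      have := (hb.comp continuous_snd).tendsto (y₀, p₀)
      simpa [h₀, Function.comp_def] using this
    have h₂ : radial (F y₀) p₀ = p₀ := by
      simpa [sub_eq_zero, h₀] using hle y₀ p₀
    have := h₁.add (continuous_snd.tendsto (y₀, p₀))
    simpa [ContinuousAt, h₂] using this
  rw [continuous_iff_continuousAt]
  rintro ⟨y₀, p₀⟩
  by_cases h₀ : ‖p₀‖ = 0
  · exact bound (fun p => exp C * ‖p‖) (by fun_prop)
      (fun y p => (norm_radial_sub_le (hC y) p).1) y₀ p₀ (by simp [h₀])
  by_cases h₁ : 1 ≤ ‖p₀‖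
  · exact bound (fun p => exp C * max 0 (1 - ‖p‖)) (by fun_prop)
      (fun y p => (norm_radial_sub_le (hC y) p).2) y₀ p₀ (by simp [h₁])
  have h₀' : 0 < ‖p₀‖ := lt_of_le_of_ne (norm_nonneg _) (Ne.symm h₀)
  push Not at h₁
  have hev : ∀ᶠ q : Y × E in 𝓝 (y₀, p₀), 0 < ‖q.2‖ ∧ ‖q.2‖ < 1 := by
    have hn : Tendsto (fun q : Y × E => ‖q.2‖) (𝓝 (y₀, p₀)) (𝓝 ‖p₀‖) :=
      (continuous_snd.norm).tendsto (y₀, p₀)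
    exact hn.eventually (Ioo_mem_nhds h₀' h₁)
  refine ContinuousAt.congr (f := fun q : Y × E =>
    (sigmoid (F q.1 (logit ‖q.2‖)) / ‖q.2‖) • q.2) ?_
    (hev.mono fun q hq => (if_pos hq).symm)
  have hn : ContinuousAt (fun q : Y × E => ‖q.2‖) (y₀, p₀) := continuous_snd.norm.continuousAt
  have hl : ContinuousAt (fun q : Y × E => logit ‖q.2‖) (y₀, p₀) :=
    (hn.div (continuousAt_const.sub hn) (sub_pos.2 h₁).ne').log
      (div_pos h₀' (sub_pos.2 h₁)).ne'
  have hFl : ContinuousAt (fun q : Y × E => F q.1 (logit ‖q.2‖)) (y₀, p₀) :=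
    ContinuousAt.comp (g := fun q : Y × ℝ => F q.1 q.2) (f := fun q : Y × E => (q.1, logit ‖q.2‖))
      hF.continuousAt (continuousAt_fst.prodMk hl)
  exact ((continuous_sigmoid.continuousAt.comp hFl).div hn h₀).smul continuousAt_snd

/-! ### Homeomorphisms supported in a chart -/

section Chart

variable {M : Type*} [TopologicalSpace M]

open Classical in
/-- The radial map in a chart, extended by the identity. -/
noncomputable def chartMap (e : OpenPartialHomeomorph M E) (F : ℝ → ℝ) (p : M) : M :=
  if p ∈ e.source then e.symm (radial F (e p)) else p

/-- The point of a chart in the direction `u` at the distance `sigmoid t` from the centre. -/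
noncomputable def ray (e : OpenPartialHomeomorph M E) (u : E) (t : ℝ) : M :=
  e.symm (sigmoid t • u)

variable {e : OpenPartialHomeomorph M E} (he : Metric.closedBall 0 1 ⊆ e.target)
include he

theorem sigmoid_smul_mem_target {u : E} (hu : ‖u‖ = 1) (t : ℝ) : sigmoid t • u ∈ e.target :=
  he (by rw [mem_closedBall_zero_iff, norm_sigmoid_smul hu]; exact sigmoid_le_one t)

theorem radial_mem_target (F : ℝ → ℝ) {v : E} (hv : v ∈ e.target) : radial F v ∈ e.target := by
  rcases le_total ‖v‖ 1 with h | h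
  · exact he (mem_closedBall_zero_iff.2 (norm_radial_le F h))
  · rwa [radial_of_one_le F h]

theorem chartMap_ray (F : ℝ → ℝ) {u : E} (hu : ‖u‖ = 1) (t : ℝ) :
    chartMap e F (ray e u t) = ray e u (F t) := by
  have h := sigmoid_smul_mem_target he hu t
  rw [ray, chartMap, if_pos (e.map_target h), e.right_inv h, radial_sigmoid_smul F hu, ray]

omit he in
-- This reduces identities between chart maps to identities on the line.
theorem chartMap_cases (p : M) :
    (∃ (u : E) (t : ℝ), ‖u‖ = 1 ∧ p = ray e u t) ∨ ∀ F, chartMap e F p = p := by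
  by_cases hp : p ∈ e.source
  · rcases radial_cases (e p) with ⟨u, t, hu, h⟩ | h
    · exact Or.inl ⟨u, t, hu, by rw [ray, ← h, e.left_inv hp]⟩
    · exact Or.inr fun F => by rw [chartMap, if_pos hp, h, e.left_inv hp]
  · exact Or.inr fun F => if_neg hp

theorem chartMap_chartMap (F G : ℝ → ℝ) (p : M) :
    chartMap e F (chartMap e G p) = chartMap e (F ∘ G) p := by
  rcases chartMap_cases (e := e) p with ⟨u, t, hu, rfl⟩ | h
  · simp only [chartMap_ray he _ hu, Function.comp_apply]
  · simp only [h]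

theorem chartMap_id (p : M) : chartMap e id p = p := by
  rcases chartMap_cases (e := e) p with ⟨u, t, hu, rfl⟩ | h
  · rw [chartMap_ray he _ hu, id]
  · exact h _

theorem ray_injective {u v : E} (hu : ‖u‖ = 1) (hv : ‖v‖ = 1) {s t : ℝ}
    (h : ray e u s = ray e v t) : u = v ∧ s = t := by
  have h' := e.symm.injOn (sigmoid_smul_mem_target he hu s) (sigmoid_smul_mem_target he hv t) h
  have hst : sigmoid s = sigmoid t := by
    simpa only [norm_sigmoid_smul hu, norm_sigmoid_smul hv] using congrArg norm h'
  refine ⟨?_, sigmoid_injective hst⟩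
  rw [hst] at h'
  exact smul_right_injective E (sigmoid_pos t).ne' h'

theorem continuous_ray {u : E} (hu : ‖u‖ = 1) : Continuous (ray e u) :=
  e.symm.continuousOn.comp_continuous (continuous_sigmoid.smul continuous_const)
    (sigmoid_smul_mem_target he hu)

theorem continuous_chartMap [T2Space M] [ProperSpace E] {Y : Type*} [TopologicalSpace Y]
    {F : Y → ℝ → ℝ} (hF : Continuous fun q : Y × ℝ => F q.1 q.2) {C : ℝ}
    (hC : ∀ y t, |F y t - t| ≤ C) : Continuous fun q : Y × M => chartMap e (F q.1) q.2 := by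
  -- Compact in a Hausdorff space. Off this set the map is the identity, which gives continuity at
  -- points outside the chart.
  have hcl : IsClosed (e.symm '' Metric.closedBall 0 1) :=
    ((isCompact_closedBall (0 : E) 1).image_of_continuousOn (e.symm.continuousOn.mono he)).isClosed
  rw [continuous_iff_continuousAt]
  rintro ⟨y₀, p₀⟩
  by_cases hp : p₀ ∈ e.source
  · have hev : ∀ᶠ q : Y × M in 𝓝 (y₀, p₀), q.2 ∈ e.source :=
      continuousAt_snd.eventually (e.open_source.mem_nhds hp)
    refine ContinuousAt.congr (f := fun q : Y × M => e.symm (radial (F q.1) (e q.2))) ?_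
      (hev.mono fun q hq => (if_pos hq).symm)
    refine ContinuousAt.comp (g := e.symm) (e.symm.continuousAt
      (radial_mem_target he _ (e.map_source hp))) ?_
    refine ContinuousAt.comp (g := fun q : Y × E => radial (F q.1) q.2)
      (f := fun q : Y × M => (q.1, e q.2)) (continuous_radial hF hC).continuousAt ?_
    exact continuousAt_fst.prodMk (ContinuousAt.comp (g := e) (f := Prod.snd)
      (e.continuousAt hp) continuousAt_snd)
  · have hp' : p₀ ∈ (e.symm '' Metric.closedBall 0 1)ᶜ := by
      rintro ⟨v, hv, rfl⟩
      exact hp (e.map_target (he hv))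
    have hev : ∀ᶠ q : Y × M in 𝓝 (y₀, p₀), q.2 ∈ (e.symm '' Metric.closedBall 0 1)ᶜ :=
      continuousAt_snd.eventually (hcl.isOpen_compl.mem_nhds hp')
    refine continuousAt_snd.congr (hev.mono fun q hq => ?_)
    change q.2 = chartMap e (F q.1) q.2
    by_cases hq' : q.2 ∈ e.source
    · have : 1 ≤ ‖e q.2‖ := by
        by_contra! h
        exact hq ⟨e q.2, mem_closedBall_zero_iff.2 h.le, e.left_inv hq'⟩
      rw [chartMap, if_pos hq', radial_of_one_le _ this, e.left_inv hq']
    · exact (if_neg hq').symm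

omit he in
theorem abs_symm_sub_le {F : ℝ ≃ₜ ℝ} {C : ℝ} (hC : ∀ t, |F t - t| ≤ C) (t : ℝ) :
    |F.symm t - t| ≤ C := by
  simpa [abs_sub_comm] using hC (F.symm t)

/-- The homeomorphism of `M` that is given in a chart by a homeomorphism of the line of bounded
displacement. -/
noncomputable def chartHomeo [T2Space M] [ProperSpace E] (F : ℝ ≃ₜ ℝ)
    (hF : ∃ C, ∀ t, |F t - t| ≤ C) : M ≃ₜ M where
  toFun := chartMap e F
  invFun := chartMap e F.symm
  left_inv p := by
    rw [chartMap_chartMap he, Homeomorph.symm_comp_self, chartMap_id he]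
  right_inv p := by
    rw [chartMap_chartMap he, Homeomorph.self_comp_symm, chartMap_id he]
  continuous_toFun := by
    obtain ⟨C, hC⟩ := hF
    exact (continuous_chartMap he (Y := Unit) (F := fun _ => F) (F.continuous.comp continuous_snd)
      (fun _ => hC)).comp (Continuous.prodMk_right ())
  continuous_invFun := by
    obtain ⟨C, hC⟩ := hF
    exact (continuous_chartMap he (Y := Unit) (F := fun _ => F.symm)
      (F.symm.continuous.comp continuous_snd) (fun _ => abs_symm_sub_le hC)).comp
        (Continuous.prodMk_right ())

end Chart

end HomeoTypes
namespace HomeoTypes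

open Set Filter Topology

/-! ### Heteroclinic connections -/

section Heteroclinic

variable {M : Type*} [TopologicalSpace M]

/-- Some point that is not fixed by `g` tends to `s` in the past and to `s'` in the future. -/
def Heteroclinic (g : M ≃ₜ M) (s s' : M) : Prop :=
  ∃ p, g p ≠ p ∧ Tendsto (fun j => g^[j] p) atTop (𝓝 s') ∧
    Tendsto (fun j => g.symm^[j] p) atTop (𝓝 s)

theorem Heteroclinic.conj {g : M ≃ₜ M} {s s' : M} (h : Heteroclinic g s s') (k : M ≃ₜ M) :
    Heteroclinic (k * g * k⁻¹) (k s) (k s') := by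
  obtain ⟨p, hp, h₁, h₂⟩ := h
  have e₁ : Function.Semiconj k g (k * g * k⁻¹ : M ≃ₜ M) := fun q => by
    simp [Homeomorph.mul_apply]
  have e₂ : Function.Semiconj k g.symm (k * g * k⁻¹ : M ≃ₜ M).symm := fun q => by
    rw [eq_comm, Homeomorph.symm_apply_eq, ← e₁.eq, Homeomorph.apply_symm_apply]
  refine ⟨k p, fun h => hp (k.injective (by rw [e₁.eq, h])), ?_, ?_⟩
  · exact ((k.continuous.tendsto _).comp h₁).congr fun j => (e₁.iterate_right j).eq p
  · exact ((k.continuous.tendsto _).comp h₂).congr fun j => (e₂.iterate_right j).eq p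

end Heteroclinic

section Wobble

variable {E : Type*} [NormedAddCommGroup E] [NormedSpace ℝ E] [ProperSpace E]
  {M : Type*} [TopologicalSpace M] [T2Space M]
  {e : OpenPartialHomeomorph M E} (he : Metric.closedBall 0 1 ⊆ e.target)

/-- The map `wobble a` acting on the radius in a chart. -/
noncomputable def chartWobble (a : ℤ → ℝ) (ha : ∀ n, |a n| ≤ 1 / 2) : M ≃ₜ M :=
  chartHomeo he (wobbleHomeo a ha) ⟨1, abs_wobble_sub_le ha⟩

theorem chartWobble_apply (a : ℤ → ℝ) (ha : ∀ n, |a n| ≤ 1 / 2) (p : M) :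
    chartWobble he a ha p = chartMap e (wobble a) p := rfl

variable {a : ℤ → ℝ} (ha : ∀ n, |a n| ≤ 1 / 2) {u : E}
include ha

theorem iterate_chartWobble_ray (hu : ‖u‖ = 1) (t : ℝ) (j : ℕ) :
    (chartWobble he a ha)^[j] (ray e u t) = ray e u ((wobbleHomeo a ha)^[j] t) :=
  ((show Function.Semiconj (ray e u) (wobbleHomeo a ha) (chartWobble he a ha) from
    fun t => (chartMap_ray he _ hu t).symm).iterate_right j).eq t |>.symm

theorem iterate_chartWobble_symm_ray (hu : ‖u‖ = 1) (t : ℝ) (j : ℕ) :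
    (chartWobble he a ha).symm^[j] (ray e u t) = ray e u ((wobbleHomeo a ha).symm^[j] t) :=
  ((show Function.Semiconj (ray e u) (wobbleHomeo a ha).symm (chartWobble he a ha).symm from
    fun t => (chartMap_ray he _ hu t).symm).iterate_right j).eq t |>.symm

theorem tendsto_chartWobble_of_pos (hu : ‖u‖ = 1) {n : ℤ} (hn : 0 < a n) {t : ℝ}
    (ht : t ∈ Ioo (n : ℝ) (n + 1)) :
    Tendsto (fun j => (chartWobble he a ha)^[j] (ray e u t)) atTop (𝓝 (ray e u (n + 1))) ∧
      Tendsto (fun j => (chartWobble he a ha).symm^[j] (ray e u t)) atTop (𝓝 (ray e u n)) := by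
  simp only [iterate_chartWobble_ray he ha hu, iterate_chartWobble_symm_ray he ha hu]
  have h := tendsto_wobble_of_pos ha hn ht
  exact ⟨((continuous_ray he hu).tendsto _).comp h.1, ((continuous_ray he hu).tendsto _).comp h.2⟩

theorem tendsto_chartWobble_of_neg (hu : ‖u‖ = 1) {n : ℤ} (hn : a n < 0) {t : ℝ}
    (ht : t ∈ Ioo (n : ℝ) (n + 1)) :
    Tendsto (fun j => (chartWobble he a ha)^[j] (ray e u t)) atTop (𝓝 (ray e u n)) ∧
      Tendsto (fun j => (chartWobble he a ha).symm^[j] (ray e u t)) atTop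
        (𝓝 (ray e u (n + 1))) := by
  simp only [iterate_chartWobble_ray he ha hu, iterate_chartWobble_symm_ray he ha hu]
  have h := tendsto_wobble_of_neg ha hn ht
  exact ⟨((continuous_ray he hu).tendsto _).comp h.1, ((continuous_ray he hu).tendsto _).comp h.2⟩

theorem chartWobble_ray_ne (hu : ‖u‖ = 1) {n : ℤ} (hn : a n ≠ 0) {t : ℝ}
    (ht : t ∈ Ioo (n : ℝ) (n + 1)) : chartWobble he a ha (ray e u t) ≠ ray e u t := by
  intro h
  rw [chartWobble_apply, chartMap_ray he _ hu] at h
  have h' := (ray_injective he hu hu h).2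
  rcases hn.lt_or_gt with hn | hn
  · exact ((wobble_lt_iff ht).2 hn).ne h'
  · exact ((lt_wobble_iff ht).2 hn).ne' h'

theorem heteroclinic_of_pos (hu : ‖u‖ = 1) {n : ℤ} (hn : 0 < a n) :
    Heteroclinic (chartWobble he a ha) (ray e u n) (ray e u (n + 1)) :=
  have ht : (n + 1 / 2 : ℝ) ∈ Ioo (n : ℝ) (n + 1) := ⟨by linarith, by linarith⟩
  ⟨_, chartWobble_ray_ne he ha hu hn.ne' ht, tendsto_chartWobble_of_pos he ha hu hn ht⟩

theorem heteroclinic_of_neg (hu : ‖u‖ = 1) {n : ℤ} (hn : a n < 0) :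
    Heteroclinic (chartWobble he a ha) (ray e u (n + 1)) (ray e u n) :=
  have ht : (n + 1 / 2 : ℝ) ∈ Ioo (n : ℝ) (n + 1) := ⟨by linarith, by linarith⟩
  ⟨_, chartWobble_ray_ne he ha hu hn.ne ht, tendsto_chartWobble_of_neg he ha hu hn ht⟩

/-- A moved point lies on a ray strictly between two consecutive integer parameters, and limits in a
Hausdorff space are unique. -/
theorem Heteroclinic.exists_ray {s s' : M} (h : Heteroclinic (chartWobble he a ha) s s') :
    ∃ (v : E) (n : ℤ), ‖v‖ = 1 ∧ (0 < a n ∧ s = ray e v n ∧ s' = ray e v (n + 1) ∨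
      a n < 0 ∧ s = ray e v (n + 1) ∧ s' = ray e v n) := by
  obtain ⟨p, hp, h₁, h₂⟩ := h
  rcases chartMap_cases (e := e) p with ⟨v, t, hv, rfl⟩ | h
  swap
  · exact absurd (h _) hp
  have hfix : wobble a t ≠ t := fun h => hp (by rw [chartWobble_apply, chartMap_ray he _ hv, h])
  have ht : t ∈ Ioo (⌊t⌋ : ℝ) (⌊t⌋ + 1) := by
    refine ⟨lt_of_le_of_ne (Int.floor_le t) fun h => hfix ?_, Int.lt_floor_add_one t⟩
    rw [← h, wobble_intCast]
  have hne : a ⌊t⌋ ≠ 0 := fun h => hfix (by rw [wobble, h, zero_mul, add_zero])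
  refine ⟨v, ⌊t⌋, hv, ?_⟩
  rcases hne.lt_or_gt with hn | hn
  · have h := tendsto_chartWobble_of_neg he ha hv hn ht
    exact Or.inr ⟨hn, tendsto_nhds_unique h₂ h.2, tendsto_nhds_unique h₁ h.1⟩
  · have h := tendsto_chartWobble_of_pos he ha hv hn ht
    exact Or.inl ⟨hn, tendsto_nhds_unique h₂ h.2, tendsto_nhds_unique h₁ h.1⟩

variable {b : ℤ → ℝ} (hb : ∀ n, |b n| ≤ 1 / 2)

/-- A conjugating homeomorphism maps consecutive fixed points on a ray to consecutive fixed points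
on a ray. -/
theorem exists_ray_of_conj (hne : ∀ n, a n ≠ 0) {k : M ≃ₜ M}
    (hk : k * chartWobble he a ha * k⁻¹ = chartWobble he b hb) (hu : ‖u‖ = 1) (n : ℤ) :
    ∃ (v : E) (m : ℤ), ‖v‖ = 1 ∧
      (k (ray e u n) = ray e v m ∧ k (ray e u (n + 1)) = ray e v (m + 1) ∧ (0 < b m ↔ 0 < a n) ∨
       k (ray e u n) = ray e v (m + 1) ∧ k (ray e u (n + 1)) = ray e v m ∧
        (0 < b m ↔ ¬ 0 < a n)) := by
  rcases (hne n).lt_or_gt with hn | hn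
  · have h := (heteroclinic_of_neg he ha hu hn).conj k
    rw [hk] at h
    obtain ⟨v, m, hv, ⟨hm, h₁, h₂⟩ | ⟨hm, h₁, h₂⟩⟩ := h.exists_ray he hb
    · exact ⟨v, m, hv, Or.inr ⟨h₂, h₁, iff_of_true hm hn.not_gt⟩⟩
    · exact ⟨v, m, hv, Or.inl ⟨h₂, h₁, iff_of_false hm.not_gt hn.not_gt⟩⟩
  · have h := (heteroclinic_of_pos he ha hu hn).conj k
    rw [hk] at h
    obtain ⟨v, m, hv, ⟨hm, h₁, h₂⟩ | ⟨hm, h₁, h₂⟩⟩ := h.exists_ray he hb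
    · exact ⟨v, m, hv, Or.inl ⟨h₁, h₂, iff_of_true hm hn⟩⟩
    · exact ⟨v, m, hv, Or.inr ⟨h₁, h₂, iff_of_false hm.not_gt (not_not.2 hn)⟩⟩

/-- If the homeomorphisms given by `a` and `b` are conjugate then the sequences of signs of `a` and
`b` agree up to a shift on a half line, or up to a reflection that changes all signs. -/
theorem exists_shift_of_isConj (hne : ∀ n, a n ≠ 0) (hu : ‖u‖ = 1)
    (h : IsConj (chartWobble he a ha) (chartWobble he b hb)) :
    ∃ m : ℤ, (∀ j : ℕ, 0 < b (m + j) ↔ 0 < a j) ∨ (∀ j : ℕ, 0 < b (m - j) ↔ ¬ 0 < a j) := by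
  obtain ⟨k, hk⟩ := isConj_iff.1 h
  have hinj : ∀ {v w : E} {m n : ℤ}, ‖v‖ = 1 → ‖w‖ = 1 → ray e v m = ray e w n → v = w ∧ m = n :=
    fun hv hw h => ⟨(ray_injective he hv hw h).1, by exact_mod_cast (ray_injective he hv hw h).2⟩
  -- The image of the chain cannot turn back, so the first edge fixes the ray and the direction of
  -- all later ones.
  have hstep : ∀ n : ℤ, k (ray e u (n + 2 : ℤ)) ≠ k (ray e u n) := fun n h => by
    have := (hinj hu hu (k.injective h)).2
    omega
  have hedge : ∀ n : ℤ, ∃ (v : E) (m : ℤ), ‖v‖ = 1 ∧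
      (k (ray e u n) = ray e v m ∧ k (ray e u (n + 1 : ℤ)) = ray e v (m + 1 : ℤ) ∧
          (0 < b m ↔ 0 < a n) ∨
        k (ray e u n) = ray e v (m + 1 : ℤ) ∧ k (ray e u (n + 1 : ℤ)) = ray e v m ∧
          (0 < b m ↔ ¬ 0 < a n)) := fun n => by
    push_cast
    exact exists_ray_of_conj he ha hb hne hk hu n
  obtain ⟨v, m, hv, ⟨h₀, h₁, h₂⟩ | ⟨h₀, h₁, h₂⟩⟩ := hedge 0
  · refine ⟨m, Or.inl fun j => ?_⟩
    -- The induction also tracks the images of both ends of the edge: the far end determines where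
    -- the next edge begins, the near end excludes a reversal.
    suffices k (ray e u (j : ℤ)) = ray e v (m + j : ℤ) ∧
        k (ray e u (j + 1 : ℤ)) = ray e v (m + j + 1 : ℤ) ∧ (0 < b (m + j) ↔ 0 < a j) from this.2.2
    induction j with
    | zero => simp_all
    | succ j ih =>
      obtain ⟨w, l, hw, ⟨g₀, g₁, g₂⟩ | ⟨g₀, g₁, g₂⟩⟩ := hedge (j + 1)
      · obtain ⟨rfl, rfl⟩ := hinj hw hv (g₀.symm.trans ih.2.1)
        have : m + (j + 1 : ℕ) = m + j + 1 := by push_cast; ring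
        rw [this]
        exact ⟨g₀, g₁, g₂⟩
      · obtain ⟨rfl, hl⟩ := hinj hw hv (g₀.symm.trans ih.2.1)
        obtain rfl : l = m + j := by omega
        exact absurd (g₁.trans ih.1.symm) (by rw [add_assoc]; exact hstep j)
  · refine ⟨m, Or.inr fun j => ?_⟩
    suffices k (ray e u (j : ℤ)) = ray e v (m - j + 1 : ℤ) ∧
        k (ray e u (j + 1 : ℤ)) = ray e v (m - j : ℤ) ∧ (0 < b (m - j) ↔ ¬ 0 < a j) from this.2.2
    induction j with
    | zero => simp_all
    | succ j ih =>
      obtain ⟨w, l, hw, ⟨g₀, g₁, g₂⟩ | ⟨g₀, g₁, g₂⟩⟩ := hedge (j + 1)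
      · obtain ⟨rfl, rfl⟩ := hinj hw hv (g₀.symm.trans ih.2.1)
        exact absurd (g₁.trans ih.1.symm) (by rw [add_assoc]; exact hstep j)
      · obtain ⟨rfl, hl⟩ := hinj hw hv (g₀.symm.trans ih.2.1)
        obtain rfl : l = m - (j + 1 : ℕ) := by push_cast; omega
        exact ⟨g₀, g₁, g₂⟩

end Wobble

/-! ### The family of homeomorphisms -/

/-- The sequence of amplitudes given by the parities of the terms of `x`, scaled by `τ`. -/
noncomputable def amplitude (τ : ℝ) (x : ℕ → ℕ) (n : ℤ) : ℝ :=
  τ * if Even (x (Equiv.intEquivNat n)) then 1 / 2 else -1 / 2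

theorem abs_amplitude_le {τ : ℝ} (hτ : |τ| ≤ 1) (x : ℕ → ℕ) (n : ℤ) :
    |amplitude τ x n| ≤ 1 / 2 := by
  have : |if Even (x (Equiv.intEquivNat n)) then (1 / 2 : ℝ) else -1 / 2| = 1 / 2 := by
    split_ifs
    · exact abs_of_pos (by norm_num)
    · rw [neg_div, abs_neg]; exact abs_of_pos (by norm_num)
  rw [amplitude, abs_mul, this]
  linarith

theorem amplitude_pos_iff (x : ℕ → ℕ) (n : ℤ) :
    0 < amplitude 1 x n ↔ Even (x (Equiv.intEquivNat n)) := by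
  rw [amplitude, one_mul]
  split_ifs with h
  · simp [h]
  · simp only [h, iff_false]
    norm_num

theorem amplitude_ne_zero (x : ℕ → ℕ) (n : ℤ) : amplitude 1 x n ≠ 0 := by
  rw [amplitude, one_mul]
  split_ifs <;> norm_num

theorem amplitude_shift (τ : ℝ) (k : ℤ) (x : ℕ → ℕ) (n : ℤ) :
    amplitude τ (shift k x) n = amplitude τ x (n + k) := by
  simp [amplitude, shift]

theorem continuous_amplitude : Continuous fun q : ℝ × (ℕ → ℕ) => amplitude q.1 q.2 := by
  refine continuous_pi fun n => continuous_fst.mul ?_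
  exact (continuous_of_discreteTopology
    (f := fun i : ℕ => if Even i then (1 / 2 : ℝ) else -1 / 2)).comp
    ((continuous_apply _).comp continuous_snd)

section Family

variable {E : Type*} [NormedAddCommGroup E] [NormedSpace ℝ E] [ProperSpace E]
  {M : Type*} [TopologicalSpace M] [T2Space M]
  {e : OpenPartialHomeomorph M E} (he : Metric.closedBall 0 1 ⊆ e.target)

theorem abs_one_le : |(1 : ℝ)| ≤ 1 := abs_one.le

/-- The homeomorphism of `M` that moves points radially in a chart according to the parities of the
terms of `x`. -/
noncomputable def parityHomeo (x : ℕ → ℕ) : M ≃ₜ M :=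
  chartWobble he (amplitude 1 x) (abs_amplitude_le abs_one_le x)

theorem continuous_parityHomeo : Continuous fun q : (ℕ → ℕ) × M => parityHomeo he q.1 q.2 := by
  refine continuous_chartMap he (F := fun x => wobble (amplitude 1 x)) ?_
    (fun x => abs_wobble_sub_le (abs_amplitude_le abs_one_le x))
  exact continuous_wobble.comp (f := fun q : (ℕ → ℕ) × ℝ => (amplitude 1 q.1, q.2))
    ((continuous_amplitude.comp (f := fun q : (ℕ → ℕ) × ℝ => ((1 : ℝ), q.1))
      (by fun_prop)).prodMk continuous_snd)

theorem parityHomeo_mem_homeoZero (x : ℕ → ℕ) : parityHomeo he x ∈ HomeoZero M := by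
  have hτ : ∀ τ : unitInterval, |(τ : ℝ)| ≤ 1 := fun τ =>
    abs_le.2 ⟨by linarith [τ.2.1], τ.2.2⟩
  refine ⟨fun τ => chartWobble he (amplitude τ x) (abs_amplitude_le (hτ τ) x), ?_, ?_, rfl⟩
  · refine continuous_chartMap he (F := fun τ : unitInterval => wobble (amplitude τ x)) ?_
      (fun τ => abs_wobble_sub_le (abs_amplitude_le (hτ τ) x))
    exact continuous_wobble.comp (f := fun q : unitInterval × ℝ => (amplitude q.1 x, q.2))
      ((continuous_amplitude.comp (f := fun q : unitInterval × ℝ => ((q.1 : ℝ), x))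
        (by fun_prop)).prodMk continuous_snd)
  · ext p
    have : wobble (amplitude ((0 : unitInterval) : ℝ) x) = id := by
      ext t
      simp [wobble, amplitude]
    rw [chartWobble_apply, this, chartMap_id he]
    rfl

theorem exists_parityHomeo_shift (k : ℤ) (x : ℕ → ℕ) :
    ∃ c, parityHomeo he (shift k x) = c * parityHomeo he x * c⁻¹ := by
  -- Translation of the radial parameter by `-k` has bounded displacement, so it extends to `M`.
  refine ⟨chartHomeo he (Homeomorph.addRight (-k : ℝ)) ⟨|(k : ℝ)|, fun t => by simp⟩, ?_⟩
  ext p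
  change chartMap e (wobble (amplitude 1 (shift k x))) p =
    chartMap e (Homeomorph.addRight (-k : ℝ)) (chartMap e (wobble (amplitude 1 x))
      (chartMap e (Homeomorph.addRight (-k : ℝ)).symm p))
  rw [chartMap_chartMap he, chartMap_chartMap he]
  congr 1
  ext t
  have := wobble_add_intCast (amplitude 1 x) t k
  simp only [← amplitude_shift] at this
  simp only [Homeomorph.addRight_symm, Function.comp_apply, Homeomorph.coe_addRight, neg_neg, this]
  ring

/-- A conjugacy would prescribe the parities of `y` on a half line, by one of countably many offsets
and one of two directions; a generic `y` violates all these prescriptions. -/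
theorem eventually_not_isConj_parityHomeo [Nontrivial E] (x : ℕ → ℕ) :
    ∀ᶠ y in residual (ℕ → ℕ), ¬ IsConj (parityHomeo he x) (parityHomeo he y) := by
  obtain ⟨u, hu⟩ := exists_norm_eq E zero_le_one
  have h₁ : ∀ᶠ y in residual (ℕ → ℕ), ∀ m : ℤ, ∃ j : ℕ,
      ¬ (Even (y (Equiv.intEquivNat (m + j))) ↔ Even (x (Equiv.intEquivNat j))) :=
    eventually_countable_forall.2 fun m => eventually_exists_parity_ne
      (ι := fun j : ℕ => Equiv.intEquivNat (m + j)) (fun i j h => by simpa using h) _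
  have h₂ : ∀ᶠ y in residual (ℕ → ℕ), ∀ m : ℤ, ∃ j : ℕ,
      ¬ (Even (y (Equiv.intEquivNat (m - j))) ↔ ¬ Even (x (Equiv.intEquivNat j))) :=
    eventually_countable_forall.2 fun m => eventually_exists_parity_ne
      (ι := fun j : ℕ => Equiv.intEquivNat (m - j)) (fun i j h => by simpa using h) _
  filter_upwards [h₁, h₂] with y hy₁ hy₂ h
  obtain ⟨m, h | h⟩ := exists_shift_of_isConj he _ _ (amplitude_ne_zero x) hu h
  · obtain ⟨j, hj⟩ := hy₁ m
    exact hj (by simpa only [amplitude_pos_iff] using h j)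
  · obtain ⟨j, hj⟩ := hy₂ m
    exact hj (by simpa only [amplitude_pos_iff] using h j)

end Family

end HomeoTypes
namespace HomeoTypes

open Set Filter Topology MeasureTheory

/-! ### Manifolds -/

section Manifold

variable {d : ℕ} [NeZero d]

theorem exists_openPartialHomeomorph_halfSpace :
    ∃ e : OpenPartialHomeomorph (EuclideanHalfSpace d) (EuclideanSpace ℝ (Fin d)),
      e.source = {x | 0 < x.1 0} := by
  let W := {x : EuclideanSpace ℝ (Fin d) | 0 < x 0}
  have hW : IsOpen W := isOpen_lt continuous_const (by fun_prop)
  let i : W → EuclideanHalfSpace d := fun w => ⟨w.1, le_of_lt w.2⟩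
  have hrange : range i = {x | 0 < x.1 0} := by
    ext x
    exact ⟨by rintro ⟨w, rfl⟩; exact w.2, fun hx => ⟨⟨x.1, hx⟩, rfl⟩⟩
  have hi : IsOpenEmbedding i := by
    refine ⟨IsEmbedding.of_comp (g := Subtype.val) (by fun_prop) continuous_subtype_val
      IsEmbedding.subtypeVal, ?_⟩
    rw [hrange]
    exact isOpen_lt continuous_const (by fun_prop)
  have : Nonempty W := ⟨⟨EuclideanSpace.single 0 1, by simp [W]⟩⟩
  refine ⟨(hi.toOpenPartialHomeomorph i).symm.trans
    (hW.isOpenEmbedding_subtypeVal.toOpenPartialHomeomorph _), ?_⟩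
  simp [hrange]

theorem exists_mem_pos_of_isOpen {V : Set (EuclideanHalfSpace d)} (hV : IsOpen V)
    (hne : V.Nonempty) : ∃ x ∈ V, 0 < x.1 0 := by
  obtain ⟨x, hx⟩ := hne
  -- A push into the interior; the absolute value keeps the curve in the half-space for every real
  -- `ε`.
  let f : ℝ → EuclideanHalfSpace d := fun ε => ⟨x.1 + |ε| • EuclideanSpace.single 0 1, by
    have : 0 ≤ x.1 0 := x.2
    simp
    positivity⟩
  have hf : Continuous f := by
    refine Continuous.subtype_mk ?_ _
    fun_prop
  have h₀ : f 0 = x := Subtype.ext (by simp [f])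
  have hev : ∀ᶠ ε in 𝓝 (0 : ℝ), f ε ∈ V := hf.continuousAt.eventually (by
    rw [h₀]; exact hV.mem_nhds hx)
  obtain ⟨ε, hε, hpos⟩ := ((hev.filter_mono nhdsWithin_le_nhds).and
    (self_mem_nhdsWithin : Ioi (0 : ℝ) ∈ 𝓝[>] 0)).exists
  refine ⟨f ε, hε, ?_⟩
  have : 0 ≤ x.1 0 := x.2
  have hε' : 0 < |ε| := abs_pos.2 (ne_of_gt hpos)
  simp [f]
  linarith

variable {M : Type*} [TopologicalSpace M]

/-- A nonempty manifold has an interior chart whose target contains the closed unit ball. -/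
theorem IsManifoldOfDim.exists_chart_closedBall [Nonempty M] (hM : IsManifoldOfDim d M) :
    ∃ e : OpenPartialHomeomorph M (EuclideanSpace ℝ (Fin d)),
      Metric.closedBall 0 1 ⊆ e.target := by
  obtain ⟨e, he⟩ : ∃ e : OpenPartialHomeomorph M (EuclideanSpace ℝ (Fin d)),
      e.target.Nonempty := by
    obtain ⟨p⟩ := ‹Nonempty M›
    rcases hM.exists_chart p with ⟨e, hp⟩ | ⟨e, hp⟩
    · exact ⟨e, e p, e.map_source hp⟩
    · obtain ⟨x, hx, hpos⟩ := exists_mem_pos_of_isOpen e.open_target ⟨e p, e.map_source hp⟩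
      obtain ⟨i, hi⟩ := exists_openPartialHomeomorph_halfSpace (d := d)
      refine ⟨e.trans i, (e.trans i) (e.symm x), (e.trans i).map_source ?_⟩
      rw [OpenPartialHomeomorph.trans_source, hi]
      exact ⟨e.map_target hx, by simpa [e.right_inv hx] using hpos⟩
  obtain ⟨v, hv⟩ := he
  obtain ⟨ρ, hρ, hball⟩ := Metric.isOpen_iff.1 e.open_target v hv
  -- Rescaling by `ρ / 2` carries the closed unit ball into the open ball of radius `ρ` around `v`.
  refine ⟨e.transHomeomorph
    ((Homeomorph.smulOfNeZero (ρ / 2) (by positivity)).trans (Homeomorph.addLeft v)).symm, ?_⟩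
  intro w hw
  refine hball ?_
  rw [mem_closedBall_zero_iff] at hw
  change v + (ρ / 2) • w ∈ Metric.ball v ρ
  rw [mem_ball_iff_norm, add_sub_cancel_left, norm_smul, Real.norm_of_nonneg (by positivity)]
  nlinarith

theorem analyticSet_source {X : Type*} [TopologicalSpace X] [PolishSpace X]
    (e : OpenPartialHomeomorph M X) : AnalyticSet e.source := by
  rw [← e.symm_image_target_eq_source]
  refine AnalyticSet.image_of_continuousOn ?_ e.continuousOn_symm
  simpa using e.open_target.analyticSet_image continuous_id

theorem polishSpace_euclideanHalfSpace : PolishSpace (EuclideanHalfSpace d) :=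
  IsClosed.polishSpace (s := {x : EuclideanSpace ℝ (Fin d) | 0 ≤ x 0})
    (isClosed_le continuous_const (by fun_prop))

/-- A nonempty manifold is a continuous image of Baire space. -/
theorem IsManifoldOfDim.exists_continuous_surjective [Nonempty M] (hM : IsManifoldOfDim d M) :
    ∃ π : (ℕ → ℕ) → M, Continuous π ∧ Function.Surjective π := by
  have := hM.secondCountable
  have := polishSpace_euclideanHalfSpace (d := d)
  -- Chart domains are analytic, and countably many of them cover `M` by second countability.
  have hloc : ∀ p : M, ∃ V ∈ 𝓝 p, AnalyticSet V := fun p => by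
    rcases hM.exists_chart p with ⟨e, hp⟩ | ⟨e, hp⟩
    · exact ⟨e.source, e.open_source.mem_nhds hp, analyticSet_source e⟩
    · exact ⟨e.source, e.open_source.mem_nhds hp, analyticSet_source e⟩
  choose V hV hVa using hloc
  obtain ⟨s, hs, hsV⟩ := TopologicalSpace.countable_cover_nhds hV
  have := hs.to_subtype
  have huniv : AnalyticSet (univ : Set M) := by
    rw [← hsV, biUnion_eq_iUnion]
    exact AnalyticSet.iUnion fun p => hVa p
  rw [AnalyticSet] at huniv
  rcases huniv with h | ⟨π, hπ, h⟩
  · exact absurd h univ_nonempty.ne_empty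
  · exact ⟨π, hπ, range_eq_univ.1 h⟩

theorem exists_isTopologicalBasis_range [Nonempty M] [SecondCountableTopology M] :
    ∃ U : ℕ → Set M, TopologicalSpace.IsTopologicalBasis (range U) := by
  obtain ⟨B, hB, -, hBas⟩ := TopologicalSpace.exists_countable_basis M
  have hne : B.Nonempty := by
    obtain ⟨p⟩ := ‹Nonempty M›
    obtain ⟨V, hV, -⟩ := hBas.exists_subset_of_mem_open (mem_univ p) isOpen_univ
    exact ⟨V, hV⟩
  obtain ⟨U, rfl⟩ := hB.exists_eq_range hne
  exact ⟨U, hBas⟩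

end Manifold

end HomeoTypes

theorem theorem1p6 (hPD : HomeoTypes.ProjectiveDeterminacy)
    (d : ℕ) [NeZero d] (M : Type*) [TopologicalSpace M] [Nonempty M]
    (hM : HomeoTypes.IsManifoldOfDim d M) :
    ∃ g₁ g₂ : M ≃ₜ M,
      g₁ ∈ HomeoTypes.HomeoZero M ∧ g₂ ∈ HomeoTypes.HomeoZero M ∧
        HomeoTypes.tp g₁ = HomeoTypes.tp g₂ ∧ ¬ IsConj g₁ g₂ := by
  have := hM.t2
  have := hM.secondCountable
  -- This makes the Euclidean space nontrivial, so that unit vectors, and with them rays, exist.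
  have : Nonempty (Fin d) := ⟨0⟩
  obtain ⟨e, he⟩ := hM.exists_chart_closedBall
  obtain ⟨π, hπ, hs⟩ := hM.exists_continuous_surjective
  obtain ⟨U, hU⟩ := HomeoTypes.exists_isTopologicalBasis_range (M := M)
  obtain ⟨x, y, htp, hconj⟩ := HomeoTypes.exists_tp_eq_not_isConj hPD
    (HomeoTypes.projectivelyCoded_decode hU hπ hs) (HomeoTypes.parityHomeo he)
    (HomeoTypes.isProjective_decode_eq hU hπ hs (HomeoTypes.continuous_parityHomeo he))
    (HomeoTypes.exists_parityHomeo_shift he) (HomeoTypes.eventually_not_isConj_parityHomeo he)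
  exact ⟨_, _, HomeoTypes.parityHomeo_mem_homeoZero he x,
    HomeoTypes.parityHomeo_mem_homeoZero he y, htp, hconj⟩
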